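/- Let $n$ agents communicate over a connected undirected graph $G$ on $\{1,\dots,n\}$. Let $W=[w_{ij}]\in\mathbb{R}^{n\times n}$ be a (not necessarily symmetric) doubly stochastic matrix with $w_{ij}>0$ if $i=j$ or $\{i,j\}$ is an edge of $G$, and $w_{ij}=0$ otherwise. Let $\sigma$ be the second largest singular value of $W$ (read as $0$ when $n=1$). Let $L>0$, let each $f_i:\mathbb{R}^N\to\mathbb{R}$ be convex and differentiable with $\|\nabla f_i(x)-\nabla f_i(y)\|\le L\|x-y\|$ for all $x,y$ (Euclidean norm), and let $f=\frac1n\sum_{i=1}^n f_i$. Assume that the set of minimizers of $f$ is compact, let $x^*$ be a minimizer of $f$, and let $f^*=f(x^*)$. Let $\epsilon\in(0,1.4)$, $\beta=0.6+\epsilon$, $\eta>0$, let $t_0\ge 1$ be real, and let $\eta_t=\frac{\eta}{(t+t_0)^\beta}$. Algorithm Acc-DNGD-NSC starts from $x_i(0)=v_i(0)=y_i(0)=0$, $s_i(0)=\nabla f(0)$ and iterates, for $t\ge 0$, $$x_i(t+1)=\sum_{j=1}^n w_{ij}y_j(t)-\eta_t s_i(t),\qquad v_i(t+1)=\sum_{j=1}^n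 w_{ij}v_j(t)-\frac{\eta_t}{\alpha_t}s_i(t),$$ $$y_i(t+1)=(1-\alpha_{t+1})x_i(t+1)+\alpha_{t+1}v_i(t+1),\qquad s_i(t+1)=\sum_{j=1}^n w_{ij}s_j(t)+\nabla f_i(y_i(t+1))-\nabla f_i(y_i(t)),$$ where $\alpha_0=\sqrt{\eta_0L}$ and $\alpha_{t+1}$ is the unique solution in $(0,1)$ of $\alpha_{t+1}^2=\frac{\eta_{t+1}}{\eta_t}(1-\alpha_{t+1})\alpha_t^2$. Let $\bar x(t)=\frac1n\sum_i x_i(t)$ and $\bar v(t)=\frac1n\sum_i v_i(t)$, and assume $\bar v(0)\ne x^*$. Let $R$ be the diameter of the level set $\{x\in\mathbb{R}^N: f(x)\le 2f(\bar x(0))-f^*+2L\|\bar v(0)-x^*\|^2\}$ (which is bounded because the minimizer set is compact), and let $D(\beta,t_0)=\frac{1}{(t_0+3)^2e^{16+\frac{6}{2-\beta}}}$. Suppose that $$\text{(i)}\quad t_0>\frac{1}{\min\Big(\big(\frac{\sigma+3}{\sigma+2}\cdot\frac34\big)^{\sigma/(28\beta)},\ \big(\frac{16}{15+\sigma}\big)^{1/\beta}\Big)-1},$$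 $$\text{(ii)}\quad \eta<\min\Big(\frac{\sigma^2}{9^3L},\ \frac{(1-\sigma)^3}{6144L}\Big),$$ $$\text{(iii)}\quad \eta<\left(\frac{D(\beta,t_0)\,(\beta-0.6)\,(1-\sigma)^2}{9216\,(t_0+1)^{2-\beta}L^{2/3}\big[4+R^2/\|\bar v(0)-x^*\|^2\big]}\right)^{3/2}.$$ Then, as $t\to\infty$, (a) $f(\bar x(t))-f^*=O\big(\frac{1}{t^{2-\beta}}\big)=O\big(\frac{1}{t^{1.4-\epsilon}}\big)$; and (b) for every agent $i$, $f(y_i(t))-f^*=O\big(\frac{1}{t^{1.4-\epsilon}}\big)$. -/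

import Mathlib

open Filter Asymptotics

noncomputable section

/-- `W` is a consensus matrix for the communication graph `G`: its entries are positive on the
edges of `G` and on the diagonal and zero elsewhere, and it is doubly stochastic
(not necessarily symmetric). -/
structure IsConsensusMatrix {n : ℕ} (G : SimpleGraph (Fin n)) (W : Matrix (Fin n) (Fin n) ℝ) :
    Prop where
  pos_of_adj : ∀ i j, G.Adj i j → 0 < W i j
  pos_diag : ∀ i, 0 < W i i
  eq_zero : ∀ i j, i ≠ j → ¬ G.Adj i j → W i j = 0
  doublyStochastic : W ∈ doublyStochastic ℝ (Fin n)

/-- The second largest singular value of `W`, counted with multiplicity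
(Mathlib's singular values are in decreasing order and indexed from `0`). -/
def secondSingularValue {n : ℕ} (W : Matrix (Fin n) (Fin n) ℝ) : ℝ :=
  (Matrix.toEuclideanLin W).singularValues 1

/-- `L`-smoothness: `f` is differentiable with `L`-Lipschitz gradient. -/
def IsLSmooth {N : ℕ} (L : ℝ) (f : EuclideanSpace ℝ (Fin N) → ℝ) : Prop :=
  Differentiable ℝ f ∧ ∀ x y, ‖gradient f x - gradient f y‖ ≤ L * ‖x - y‖

/-- The global objective: the average of the local objectives. -/
def avgObjective {n N : ℕ} (f : Fin n → EuclideanSpace ℝ (Fin N) → ℝ) :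
    EuclideanSpace ℝ (Fin N) → ℝ :=
  fun x => (1 / (n : ℝ)) * ∑ i, f i x

/-- The average over the agents of a family of vectors. -/
def agentMean {n N : ℕ} (z : Fin n → EuclideanSpace ℝ (Fin N)) : EuclideanSpace ℝ (Fin N) :=
  (1 / (n : ℝ)) • ∑ i, z i

/-- `(α, x, v, y, s)` is the run of Acc-DNGD-NSC with consensus matrix `W`, smoothness constant `L`,
local objectives `f i` and step sizes `η t`. -/
structure IsAccDNGDNSC {n N : ℕ} (W : Matrix (Fin n) (Fin n) ℝ) (L : ℝ)
    (f : Fin n → EuclideanSpace ℝ (Fin N) → ℝ) (η : ℕ → ℝ)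
    (α : ℕ → ℝ) (x v y s : ℕ → Fin n → EuclideanSpace ℝ (Fin N)) : Prop where
  alpha_zero : α 0 = √(η 0 * L)
  alpha_mem : ∀ t, α (t + 1) ∈ Set.Ioo (0 : ℝ) 1
  alpha_succ : ∀ t, α (t + 1) ^ 2 = η (t + 1) / η t * (1 - α (t + 1)) * α t ^ 2
  x_zero : ∀ i, x 0 i = 0
  v_zero : ∀ i, v 0 i = 0
  y_zero : ∀ i, y 0 i = 0
  s_zero : ∀ i, s 0 i = gradient (avgObjective f) 0
  x_succ : ∀ t i, x (t + 1) i = (∑ j, W i j • y t j) - η t • s t i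
  v_succ : ∀ t i, v (t + 1) i = (∑ j, W i j • v t j) - (η t / α t) • s t i
  y_succ : ∀ t i, y (t + 1) i = (1 - α (t + 1)) • x (t + 1) i + α (t + 1) • v (t + 1) i
  s_succ : ∀ t i, s (t + 1) i =
    (∑ j, W i j • s t j) + gradient (f i) (y (t + 1) i) - gradient (f i) (y t i)

/-- The constant `D(β, t₀) = 1 / ((t₀ + 3)² exp(16 + 6 / (2 - β)))`. -/
def stepConstD (β t₀ : ℝ) : ℝ :=
  1 / ((t₀ + 3) ^ 2 * Real.exp (16 + 6 / (2 - β)))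

/-- The `c`-level set `{x | g x ≤ c}` of `g`. -/
def levelSet {N : ℕ} (g : EuclideanSpace ℝ (Fin N) → ℝ) (c : ℝ) :
    Set (EuclideanSpace ℝ (Fin N)) :=
  {x | g x ≤ c}

end

/-!
The proof is a Lyapunov argument for small steps: it suffices that it starts to apply at some time,
since the step sizes `η t` tend to zero and the claim is asymptotic. Bars denote averages over the
agents.

The averages perform Nesterov's accelerated method with the inexact gradient `s̄ t`, which is the
average of the local gradients at the `y t i` (`agentMean_s`). The error of this oracle is `L / n`
times the squared disagreement of `y t` (`oracle_le`, `le_oracle`), and the usual estimate-sequence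
computation survives with that error (`objective_step`). Its rate is `α t ^ 2 / η t`, which loses the
factor `1 - α (t + 1)` in every step (`ratio_succ`); as `√(η t) / α t` grows by at least
`√(η (t + 1)) / 2` per step, `t * α t ≤ 2` (`mul_alpha_le`), so that the rate is `O(t ^ (β - 2))` for
the step sizes `η / (t + t₀) ^ β` (`ratio_le`).

The disagreement is contracted by the second singular value `σ < 1` of `W` in every communication
(`disagreement_mix_le`). Hence a weighted sum `V` of the disagreements of `y`, `α v` and `η s`
contracts, up to a term of order `η t * ‖ȳ (t + 1) - ȳ t‖` (`disagreement_step`), and that is of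
order `η t * (η t * ‖s̄ t‖ + α t * ‖v̄ t - x̄ t‖)`. Adding a multiple of `V ^ 2` to the energy, the
part with `s̄` is absorbed by the descent of the objective, and what remains, divided by the rate
`α t ^ 2 / η t`, is a multiple of `η t ^ 3 * ‖v̄ t - x̄ t‖ ^ 2` (`energy_step`). The coefficients are
summable because `3 β > 1`. The distance from `v̄` to the minimizer is controlled by the energy, and
that of `x̄` as well because `x̄ (t + 1)` is a convex combination of `x̄ t` and `v̄ (t + 1)`
(`agentMean_x_succ_eq_combination`). A Grönwall argument (`exists_forall_le_of_perturbed`) therefore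
bounds the energy divided by the rate (`exists_energy_bound`). This gives the rate of
`f (x̄ t) - f*`, and the same rate for the squared disagreement, from which the rate at each `y t i`
follows by smoothness (`objective_y_le`).
-/

/-! ### Smooth convex functions -/

section SmoothConvex

variable {E : Type*} [NormedAddCommGroup E] [InnerProductSpace ℝ E] [CompleteSpace E]

lemma hasDerivAt_comp_segment {f : E → ℝ} (hf : Differentiable ℝ f) (a d : E) (t : ℝ) :
    HasDerivAt (fun t : ℝ => f (a + t • d)) (inner ℝ (gradient f (a + t • d)) d) t := by
  have h1 : HasDerivAt (fun t : ℝ => a + t • d) d t := by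
    simpa using ((hasDerivAt_id t).smul_const d).const_add a
  have h2 := (hf (a + t • d)).hasFDerivAt.comp_hasDerivAt t h1
  rw [inner_gradient_left]
  exact h2

/-- A differentiable convex function lies above its tangent planes. -/
lemma ConvexOn.add_inner_gradient_le {f : E → ℝ} (hc : ConvexOn ℝ Set.univ f)
    (hf : Differentiable ℝ f) (a b : E) :
    f a + inner ℝ (gradient f a) (b - a) ≤ f b := by
  have hl : ConvexOn ℝ Set.univ (fun t : ℝ => f (a + t • (b - a))) := by
    refine (hc.comp_affineMap (AffineMap.lineMap a b)).congr fun t _ => ?_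
    simp [AffineMap.lineMap_apply, add_comm]
  have := hl.le_slope_of_hasDerivAt (Set.mem_univ 0) (Set.mem_univ 1) one_pos
    (hasDerivAt_comp_segment hf a (b - a) 0)
  simp only [slope_def_field, zero_smul, one_smul, add_zero, sub_zero, div_one,
    add_sub_cancel] at this
  linarith

/-- The quadratic upper bound of a function with `L`-Lipschitz gradient. -/
lemma le_add_inner_gradient {f : E → ℝ} {L : ℝ} (hf : Differentiable ℝ f)
    (hL : ∀ x y, ‖gradient f x - gradient f y‖ ≤ L * ‖x - y‖) (a b : E) :
    f b ≤ f a + inner ℝ (gradient f a) (b - a) + L / 2 * ‖b - a‖ ^ 2 := by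
  set d := b - a
  let φ : ℝ → ℝ := fun t => f a + t * inner ℝ (gradient f a) d + L / 2 * t ^ 2 * ‖d‖ ^ 2
    - f (a + t • d)
  have hφ : ∀ t, HasDerivAt φ (inner ℝ (gradient f a) d + L * t * ‖d‖ ^ 2
      - inner ℝ (gradient f (a + t • d)) d) t := by
    intro t
    have h1 := hasDerivAt_comp_segment hf a d t
    have h2 : HasDerivAt (fun t : ℝ => f a + t * inner ℝ (gradient f a) d
        + L / 2 * t ^ 2 * ‖d‖ ^ 2) (inner ℝ (gradient f a) d + L * t * ‖d‖ ^ 2) t := by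
      have h3 := ((hasDerivAt_id t).mul_const (inner ℝ (gradient f a) d)).const_add (f a)
      have h4 := (((hasDerivAt_id t).pow 2).const_mul (L / 2)).mul_const (‖d‖ ^ 2)
      refine (h3.add h4).congr_deriv ?_
      simp only [id]
      ring
    exact h2.sub h1
  have hmono : MonotoneOn φ (Set.Icc 0 1) := by
    refine monotoneOn_of_deriv_nonneg (convex_Icc 0 1)
      (fun t _ => (hφ t).continuousAt.continuousWithinAt)
      (fun t _ => (hφ t).differentiableAt.differentiableWithinAt) ?_
    intro t ht
    rw [interior_Icc] at ht
    rw [(hφ t).deriv]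
    have h1 : inner ℝ (gradient f (a + t • d) - gradient f a) d ≤ L * t * ‖d‖ ^ 2 := by
      refine (real_inner_le_norm _ _).trans ?_
      have := hL (a + t • d) a
      rw [add_sub_cancel_left, norm_smul, Real.norm_of_nonneg ht.1.le] at this
      nlinarith [mul_le_mul_of_nonneg_right this (norm_nonneg d)]
    rw [inner_sub_left] at h1
    linarith
  have := hmono (Set.left_mem_Icc.2 zero_le_one) (Set.right_mem_Icc.2 zero_le_one) zero_le_one
  simp only [φ, d, zero_smul, one_smul, add_zero, add_sub_cancel] at this
  linarith

/-- Moving from `z` by a gradient step of length `1 / L` decreases the function by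
`‖∇f z‖² / (2 L)`, so the gradient is controlled by the gap to the minimum. -/
lemma norm_gradient_sq_le {f : E → ℝ} {L m : ℝ} (hL0 : 0 < L) (hf : Differentiable ℝ f)
    (hL : ∀ x y, ‖gradient f x - gradient f y‖ ≤ L * ‖x - y‖) (hm : ∀ x, m ≤ f x) (z : E) :
    ‖gradient f z‖ ^ 2 ≤ 2 * L * (f z - m) := by
  have h := (hm _).trans (le_add_inner_gradient hf hL z (z - L⁻¹ • gradient f z))
  have h1 : z - L⁻¹ • gradient f z - z = -(L⁻¹ • gradient f z) := by abel
  rw [h1, inner_neg_right, inner_smul_right, real_inner_self_eq_norm_sq, norm_neg, norm_smul,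
    Real.norm_of_nonneg (inv_nonneg.2 hL0.le)] at h
  have h2 : L / 2 * (L⁻¹ * ‖gradient f z‖) ^ 2 = L⁻¹ * ‖gradient f z‖ ^ 2 / 2 := by
    field_simp
  rw [h2] at h
  have h3 : L⁻¹ * ‖gradient f z‖ ^ 2 ≤ 2 * (f z - m) := by linarith
  calc ‖gradient f z‖ ^ 2 = L * (L⁻¹ * ‖gradient f z‖ ^ 2) := by field_simp
    _ ≤ L * (2 * (f z - m)) := by gcongr
    _ = _ := by ring

end SmoothConvex

/-! ### The second singular value of a doubly stochastic matrix -/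

section SingularValue

variable {E F : Type*} [NormedAddCommGroup E] [InnerProductSpace ℝ E] [FiniteDimensional ℝ E]
  [NormedAddCommGroup F] [InnerProductSpace ℝ F] [FiniteDimensional ℝ F]

/-- On the orthogonal complement of a top right singular vector, a linear map is bounded by its
second singular value. -/
lemma LinearMap.exists_norm_le_singularValues_one (T : E →ₗ[ℝ] F) :
    ∃ e : E, ∀ z, inner ℝ e z = 0 → ‖T z‖ ≤ T.singularValues 1 * ‖z‖ := by
  rcases Nat.eq_zero_or_pos (Module.finrank ℝ E) with h0 | h0
  · have := Module.finrank_zero_iff.1 h0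
    exact ⟨0, fun z _ => by simp [Subsingleton.elim z 0]⟩
  set hT := T.isSymmetric_adjoint_comp_self
  set b := hT.eigenvectorBasis rfl
  refine ⟨b ⟨0, h0⟩, fun z hz => ?_⟩
  refine le_of_sq_le_sq ?_ (mul_nonneg (T.singularValues_nonneg 1) (norm_nonneg z))
  have h1 : ‖T z‖ ^ 2 = ∑ i : Fin _, T.singularValues (i : ℕ) ^ 2 * inner ℝ (b i) z ^ 2 := by
    rw [← real_inner_self_eq_norm_sq, ← LinearMap.adjoint_inner_right, ← b.sum_inner_mul_inner]
    refine Finset.sum_congr rfl fun i _ => ?_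
    have := hT.eigenvectorBasis_apply_self_apply rfl z i
    rw [OrthonormalBasis.repr_apply_apply, OrthonormalBasis.repr_apply_apply,
      LinearMap.comp_apply] at this
    rw [this, T.sq_singularValues_fin rfl, real_inner_comm]
    simp only [RCLike.ofReal_real_eq_id, id_eq]
    ring
  have h2 : ‖z‖ ^ 2 = ∑ i, inner ℝ (b i) z ^ 2 := by
    rw [← b.sum_sq_norm_inner_right]
    simp
  rw [h1, mul_pow, h2, Finset.mul_sum]
  refine Finset.sum_le_sum fun i _ => ?_
  rcases Nat.eq_zero_or_pos (i : ℕ) with hi | hi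
  · have : i = ⟨0, h0⟩ := Fin.ext hi
    rw [this, hz]
    simp
  · have := T.singularValues_antitone (show 1 ≤ (i : ℕ) from hi)
    have := T.singularValues_nonneg i
    gcongr

/-- If `u` is preserved in norm by `T`, and `w ⊥ u` with `T w ⊥ T u`, then `w` is contracted by the
second singular value as soon as the latter is less than one. -/
lemma LinearMap.norm_le_singularValues_one (T : E →ₗ[ℝ] F) (hT : T.singularValues 1 < 1)
    {u w : E} (hu : u ≠ 0) (hTu : ‖T u‖ = ‖u‖) (huw : inner ℝ u w = 0)
    (hTuw : inner ℝ (T u) (T w) = 0) : ‖T w‖ ≤ T.singularValues 1 * ‖w‖ := by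
  obtain ⟨e, he⟩ := T.exists_norm_le_singularValues_one
  have hs := T.singularValues_nonneg 1
  set σ := T.singularValues 1
  have hu' : 0 < ‖u‖ := norm_pos_iff.2 hu
  have hb : inner ℝ e u ≠ 0 := by
    intro h
    have := he u h
    rw [hTu] at this
    nlinarith
  -- the combination of `u` and `w` that is orthogonal to the top singular vector `e`
  set a := inner ℝ e w
  set b := inner ℝ e u
  have hz := he (a • u - b • w) (by
    rw [inner_sub_right, inner_smul_right, inner_smul_right]; ring)
  have hsq := mul_self_le_mul_self (norm_nonneg _) hz
  have e1 : ‖T (a • u - b • w)‖ * ‖T (a • u - b • w)‖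
      = a ^ 2 * ‖u‖ ^ 2 + b ^ 2 * ‖T w‖ ^ 2 := by
    rw [← sq, map_sub, map_smul, map_smul, norm_sub_sq_real, norm_smul, norm_smul, inner_smul_left,
      inner_smul_right, hTuw, mul_pow, mul_pow, hTu]
    simp
  have e2 : ‖a • u - b • w‖ ^ 2 = a ^ 2 * ‖u‖ ^ 2 + b ^ 2 * ‖w‖ ^ 2 := by
    rw [norm_sub_sq_real, norm_smul, norm_smul, inner_smul_left, inner_smul_right, huw, mul_pow,
      mul_pow]
    simp
  have e3 : (σ * ‖a • u - b • w‖) * (σ * ‖a • u - b • w‖)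
      = σ ^ 2 * (a ^ 2 * ‖u‖ ^ 2 + b ^ 2 * ‖w‖ ^ 2) := by
    rw [← e2]; ring
  rw [e1, e3] at hsq
  refine le_of_sq_le_sq ?_ (by positivity)
  have hb2 : 0 < b ^ 2 := by positivity
  have hσ2 : σ ^ 2 ≤ 1 := by nlinarith
  have : b ^ 2 * ‖T w‖ ^ 2 ≤ b ^ 2 * (σ * ‖w‖) ^ 2 := by
    nlinarith [mul_nonneg (sub_nonneg.2 hσ2) (mul_nonneg (sq_nonneg a) (sq_nonneg ‖u‖))]
  exact le_of_mul_le_mul_left this hb2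

end SingularValue

/-- A doubly stochastic matrix contracts the vectors of mean zero by its second singular value, as
it and its transpose fix the constant vectors. -/
lemma sum_sq_mulVec_le_of_doublyStochastic {n : ℕ} {W : Matrix (Fin n) (Fin n) ℝ}
    (hW : W ∈ doublyStochastic ℝ (Fin n)) (hσ : secondSingularValue W < 1) {w : Fin n → ℝ}
    (hw : ∑ i, w i = 0) :
    ∑ i, (∑ j, W i j * w j) ^ 2 ≤ secondSingularValue W ^ 2 * ∑ i, w i ^ 2 := by
  rcases Nat.eq_zero_or_pos n with rfl | hn
  · simp
  have hWrow : ∀ i, ∑ j, W i j = 1 := sum_row_of_mem_doublyStochastic hW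
  have hWcol : ∀ j, ∑ i, W i j = 1 := sum_col_of_mem_doublyStochastic hW
  set T := Matrix.toEuclideanLin W
  set u : EuclideanSpace ℝ (Fin n) := WithLp.toLp 2 fun _ => 1
  have hu : u ≠ 0 := fun h => by
    have := congrArg (fun z : EuclideanSpace ℝ (Fin n) => z ⟨0, hn⟩) h
    simp [u] at this
  have hTu : T u = u := by
    ext i
    simp [T, u, Matrix.toLpLin_apply, Matrix.mulVec, dotProduct, hWrow]
  have hTw : ∀ i, T (WithLp.toLp 2 w) i = ∑ j, W i j * w j := by
    intro i
    simp [T, Matrix.toLpLin_apply, Matrix.mulVec, dotProduct]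
  have h := T.norm_le_singularValues_one hσ (u := u) (w := WithLp.toLp 2 w) hu (by rw [hTu])
    (by simpa [u, PiLp.inner_apply] using hw) (by
      rw [hTu]
      simp only [PiLp.inner_apply, hTw]
      simp only [u, RCLike.inner_apply, conj_trivial, mul_one]
      rw [Finset.sum_comm]
      simp_rw [← Finset.sum_mul, hWcol, one_mul, hw])
  have h2 := mul_self_le_mul_self (norm_nonneg _) h
  rw [← sq, EuclideanSpace.real_norm_sq_eq] at h2
  simp only [hTw] at h2
  refine h2.trans_eq ?_
  rw [← sq, mul_pow, EuclideanSpace.real_norm_sq_eq]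
  rfl

/-! ### Averages and disagreement -/

section Disagreement

variable {n N : ℕ}

/-- The Euclidean norm `√(∑ i, ‖z i‖ ^ 2)` of the stacked vector of a family. -/
noncomputable def stackNorm (z : Fin n → EuclideanSpace ℝ (Fin N)) : ℝ := ‖WithLp.toLp 2 z‖

/-- The distance, in the stacked norm, from a family to its average (repeated for each agent). -/
noncomputable def disagreement (z : Fin n → EuclideanSpace ℝ (Fin N)) : ℝ :=
  stackNorm fun i => z i - agentMean z

/-- One round of communication: every agent takes the `W`-weighted average of the family. -/
def mix (W : Matrix (Fin n) (Fin n) ℝ) (z : Fin n → EuclideanSpace ℝ (Fin N)) :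
    Fin n → EuclideanSpace ℝ (Fin N) :=
  fun i => ∑ j, W i j • z j

lemma stackNorm_sq (z : Fin n → EuclideanSpace ℝ (Fin N)) : stackNorm z ^ 2 = ∑ i, ‖z i‖ ^ 2 :=
  PiLp.norm_sq_eq_of_L2 _ _

lemma stackNorm_nonneg (z : Fin n → EuclideanSpace ℝ (Fin N)) : 0 ≤ stackNorm z := norm_nonneg _

lemma stackNorm_add_le (z w : Fin n → EuclideanSpace ℝ (Fin N)) :
    stackNorm (z + w) ≤ stackNorm z + stackNorm w := by
  unfold stackNorm
  rw [WithLp.toLp_add]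
  exact norm_add_le _ _

lemma stackNorm_smul (c : ℝ) (z : Fin n → EuclideanSpace ℝ (Fin N)) :
    stackNorm (c • z) = |c| * stackNorm z := by
  unfold stackNorm
  rw [WithLp.toLp_smul, norm_smul, Real.norm_eq_abs]

lemma stackNorm_le_mul {c : ℝ} (hc : 0 ≤ c) {z w : Fin n → EuclideanSpace ℝ (Fin N)}
    (h : ∀ i, ‖z i‖ ≤ c * ‖w i‖) : stackNorm z ≤ c * stackNorm w := by
  refine le_of_sq_le_sq ?_ (mul_nonneg hc (stackNorm_nonneg w))
  rw [mul_pow, stackNorm_sq, stackNorm_sq, Finset.mul_sum]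
  refine Finset.sum_le_sum fun i _ => ?_
  rw [← mul_pow]
  gcongr
  exact h i

lemma stackNorm_const (a : EuclideanSpace ℝ (Fin N)) :
    stackNorm (fun _ : Fin n => a) = √n * ‖a‖ := by
  rw [← sq_eq_sq₀ (stackNorm_nonneg _) (by positivity), stackNorm_sq, mul_pow,
    Real.sq_sqrt (Nat.cast_nonneg n)]
  simp

lemma agentMean_add (z w : Fin n → EuclideanSpace ℝ (Fin N)) :
    agentMean (z + w) = agentMean z + agentMean w := by
  simp [agentMean, Finset.sum_add_distrib]

lemma agentMean_smul (c : ℝ) (z : Fin n → EuclideanSpace ℝ (Fin N)) :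
    agentMean (c • z) = c • agentMean z := by
  simp only [agentMean, Pi.smul_apply, ← Finset.smul_sum]
  rw [smul_comm]

lemma agentMean_sub (z w : Fin n → EuclideanSpace ℝ (Fin N)) :
    agentMean (z - w) = agentMean z - agentMean w := by
  simp [agentMean, Finset.sum_sub_distrib, smul_sub]

lemma agentMean_mix {W : Matrix (Fin n) (Fin n) ℝ} (hW : W ∈ doublyStochastic ℝ (Fin n))
    (z : Fin n → EuclideanSpace ℝ (Fin N)) : agentMean (mix W z) = agentMean z := by
  simp only [agentMean, mix]
  rw [Finset.sum_comm]
  simp_rw [← Finset.sum_smul, sum_col_of_mem_doublyStochastic hW, one_smul]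

lemma sum_sub_agentMean (hn : 0 < n) (z : Fin n → EuclideanSpace ℝ (Fin N)) :
    ∑ i, (z i - agentMean z) = 0 := by
  have : (n : ℝ) ≠ 0 := by positivity
  rw [Finset.sum_sub_distrib, Finset.sum_const, Finset.card_univ, Fintype.card_fin,
    ← Nat.cast_smul_eq_nsmul ℝ, agentMean, smul_smul, mul_one_div_cancel this, one_smul, sub_self]

lemma disagreement_nonneg (z : Fin n → EuclideanSpace ℝ (Fin N)) : 0 ≤ disagreement z :=
  stackNorm_nonneg _

lemma disagreement_add_le (z w : Fin n → EuclideanSpace ℝ (Fin N)) :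
    disagreement (z + w) ≤ disagreement z + disagreement w := by
  refine le_of_eq_of_le ?_ (stackNorm_add_le _ _)
  unfold disagreement
  congr 1
  ext1 i
  simp only [Pi.add_apply, agentMean_add]
  abel

lemma disagreement_smul (c : ℝ) (z : Fin n → EuclideanSpace ℝ (Fin N)) :
    disagreement (c • z) = |c| * disagreement z := by
  refine Eq.trans ?_ (stackNorm_smul _ _)
  unfold disagreement
  congr 1
  ext1 i
  simp only [Pi.smul_apply, agentMean_smul, smul_sub]

lemma disagreement_sub_smul_le {c : ℝ} (hc : 0 ≤ c) (z w : Fin n → EuclideanSpace ℝ (Fin N)) :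
    disagreement (z - c • w) ≤ disagreement z + c * disagreement w := by
  have := disagreement_add_le z ((-c) • w)
  rwa [disagreement_smul, abs_neg, abs_of_nonneg hc, neg_smul, ← sub_eq_add_neg] at this

lemma disagreement_sq (z : Fin n → EuclideanSpace ℝ (Fin N)) :
    disagreement z ^ 2 = ∑ i, ‖z i - agentMean z‖ ^ 2 :=
  stackNorm_sq _

lemma norm_sub_agentMean_le (z : Fin n → EuclideanSpace ℝ (Fin N)) (i : Fin n) :
    ‖z i - agentMean z‖ ≤ disagreement z := by
  refine le_of_sq_le_sq ?_ (disagreement_nonneg z)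
  rw [disagreement_sq]
  exact Finset.single_le_sum (f := fun i => ‖z i - agentMean z‖ ^ 2) (fun _ _ => by positivity)
    (Finset.mem_univ i)

/-- The average is the least-squares approximation by a constant family. -/
lemma disagreement_le_stackNorm (hn : 0 < n) (z : Fin n → EuclideanSpace ℝ (Fin N)) :
    disagreement z ≤ stackNorm z := by
  refine le_of_sq_le_sq ?_ (stackNorm_nonneg z)
  have h : ∀ i, ‖z i‖ ^ 2 = ‖z i - agentMean z‖ ^ 2
      + 2 * inner ℝ (z i - agentMean z) (agentMean z) + ‖agentMean z‖ ^ 2 := by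
    intro i
    rw [← norm_add_sq_real, sub_add_cancel]
  rw [disagreement_sq, stackNorm_sq]
  simp_rw [h]
  rw [Finset.sum_add_distrib, Finset.sum_add_distrib, ← Finset.mul_sum, ← sum_inner,
    sum_sub_agentMean hn, inner_zero_left]
  have : 0 ≤ ∑ _i : Fin n, ‖agentMean z‖ ^ 2 := by positivity
  linarith

/-- Communication contracts the disagreement by the second singular value. -/
lemma disagreement_mix_le (hn : 0 < n) {W : Matrix (Fin n) (Fin n) ℝ}
    (hW : W ∈ doublyStochastic ℝ (Fin n)) (hσ : secondSingularValue W < 1)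
    (z : Fin n → EuclideanSpace ℝ (Fin N)) :
    disagreement (mix W z) ≤ secondSingularValue W * disagreement z := by
  have hσ0 : 0 ≤ secondSingularValue W := LinearMap.singularValues_nonneg _ _
  refine le_of_sq_le_sq ?_ (mul_nonneg hσ0 (disagreement_nonneg z))
  have h1 : ∀ i, mix W z i - agentMean (mix W z) = ∑ j, W i j • (z j - agentMean z) := by
    intro i
    simp_rw [smul_sub, Finset.sum_sub_distrib, ← Finset.sum_smul,
      sum_row_of_mem_doublyStochastic hW, one_smul, agentMean_mix hW]
    rfl
  rw [mul_pow, disagreement_sq, disagreement_sq]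
  simp_rw [h1, EuclideanSpace.real_norm_sq_eq]
  rw [Finset.sum_comm, Finset.sum_comm (γ := Fin n) (f := fun i k => (z i - agentMean z) k ^ 2),
    Finset.mul_sum]
  refine Finset.sum_le_sum fun k _ => ?_
  have hk : ∑ j, (z j - agentMean z) k = 0 := by
    have := congrArg (fun v : EuclideanSpace ℝ (Fin N) => v k) (sum_sub_agentMean hn z)
    simpa using this
  have := sum_sq_mulVec_le_of_doublyStochastic hW hσ hk
  simpa using this

/-- The stacked difference of two families is at most the sum of their disagreements and the
(stacked) difference of their averages. -/
lemma stackNorm_sub_le (z w : Fin n → EuclideanSpace ℝ (Fin N)) :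
    stackNorm (z - w) ≤ disagreement z + disagreement w
      + √n * ‖agentMean z - agentMean w‖ := by
  have h : z - w = ((fun i => z i - agentMean z) + (-1 : ℝ) • fun i => w i - agentMean w)
      + fun _ => agentMean z - agentMean w := by
    ext1 i
    simp only [Pi.sub_apply, Pi.add_apply, Pi.neg_apply, neg_smul, one_smul]
    abel
  rw [h, ← stackNorm_const]
  refine (stackNorm_add_le _ _).trans ?_
  gcongr
  refine (stackNorm_add_le _ _).trans ?_
  rw [stackNorm_smul]
  simp [disagreement]

lemma norm_agentMean_sq_le (hn : 0 < n) (z : Fin n → EuclideanSpace ℝ (Fin N)) :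
    n * ‖agentMean z‖ ^ 2 ≤ stackNorm z ^ 2 := by
  have h0 : (0 : ℝ) < n := by positivity
  have h1 : ‖agentMean z‖ ≤ 1 / n * ∑ i, ‖z i‖ := by
    rw [agentMean, norm_smul, Real.norm_of_nonneg (by positivity)]
    gcongr
    exact norm_sum_le _ _
  have h2 : (∑ i, ‖z i‖) ^ 2 ≤ n * ∑ i, ‖z i‖ ^ 2 := by
    simpa using sq_sum_le_card_mul_sum_sq (s := Finset.univ) (f := fun i => ‖z i‖)
  rw [stackNorm_sq]
  calc (n : ℝ) * ‖agentMean z‖ ^ 2 ≤ n * (1 / n * ∑ i, ‖z i‖) ^ 2 := by gcongr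
    _ = 1 / n * (∑ i, ‖z i‖) ^ 2 := by field_simp
    _ ≤ 1 / n * (n * ∑ i, ‖z i‖ ^ 2) := by gcongr
    _ = _ := by field_simp

end Disagreement

/-! ### The averaged objective and the inexact oracle -/

section Oracle

variable {n N : ℕ} {f : Fin n → EuclideanSpace ℝ (Fin N) → ℝ} {L : ℝ}

lemma differentiable_avgObjective (hf : ∀ i, IsLSmooth L (f i)) :
    Differentiable ℝ (avgObjective f) :=
  (Differentiable.fun_sum fun i _ => (hf i).1).const_mul _

lemma gradient_avgObjective (hf : ∀ i, IsLSmooth L (f i)) (z : EuclideanSpace ℝ (Fin N)) :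
    gradient (avgObjective f) z = agentMean fun i => gradient (f i) z := by
  refine HasGradientAt.gradient ?_
  rw [hasGradientAt_iff_hasFDerivAt]
  have h := (HasFDerivAt.fun_sum (u := Finset.univ) fun i (_ : i ∈ Finset.univ) =>
    ((hf i).1 z).hasGradientAt.hasFDerivAt).const_mul (1 / (n : ℝ))
  refine h.congr_fderiv ?_
  rw [agentMean, map_smul, map_sum]

lemma convexOn_avgObjective (hc : ∀ i, ConvexOn ℝ Set.univ (f i)) :
    ConvexOn ℝ Set.univ (avgObjective f) := by
  have h : ConvexOn ℝ Set.univ (∑ i, f i) :=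
    Finset.sum_induction _ (ConvexOn ℝ Set.univ) (fun _ _ => ConvexOn.add)
      (convexOn_const 0 convex_univ) fun i _ => hc i
  refine (h.smul (c := 1 / (n : ℝ)) (by positivity)).congr fun z _ => ?_
  simp [avgObjective]

/-- The average of the local gradients is Lipschitz in the stacked norm. Taking all `w i` equal to
the average of the `z i` compares it with the gradient of the objective at that average. -/
lemma card_mul_norm_agentMean_gradient_sub_sq_le (hn : 0 < n) (hL : 0 < L)
    (hf : ∀ i, IsLSmooth L (f i)) (z w : Fin n → EuclideanSpace ℝ (Fin N)) :
    n * ‖agentMean (fun i => gradient (f i) (z i)) - agentMean (fun i => gradient (f i) (w i))‖ ^ 2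
      ≤ L ^ 2 * stackNorm (z - w) ^ 2 := by
  rw [← agentMean_sub]
  refine (norm_agentMean_sq_le hn _).trans ?_
  rw [← mul_pow]
  refine pow_le_pow_left₀ (stackNorm_nonneg _) ?_ 2
  exact stackNorm_le_mul hL.le fun i => (hf i).2 _ _

lemma norm_gradient_avgObjective_sub_le (hn : 0 < n) (hL : 0 < L)
    (hf : ∀ i, IsLSmooth L (f i)) (a b : EuclideanSpace ℝ (Fin N)) :
    ‖gradient (avgObjective f) a - gradient (avgObjective f) b‖ ≤ L * ‖a - b‖ := by
  have h := card_mul_norm_agentMean_gradient_sub_sq_le hn hL hf (fun _ => a) (fun _ => b)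
  rw [← gradient_avgObjective hf, ← gradient_avgObjective hf] at h
  have h1 : stackNorm ((fun _ : Fin n => a) - fun _ => b) = √n * ‖a - b‖ := stackNorm_const (a - b)
  rw [h1, mul_pow, Real.sq_sqrt (Nat.cast_nonneg n)] at h
  have hn' : (0 : ℝ) < n := by positivity
  refine le_of_sq_le_sq ?_ (by positivity)
  refine le_of_mul_le_mul_left ?_ hn'
  linarith

/-- The value at `agentMean y` of the minorant of the objective which the local tangent planes at
the points `y i` define. -/
noncomputable def oracleValue (f : Fin n → EuclideanSpace ℝ (Fin N) → ℝ)
    (y : Fin n → EuclideanSpace ℝ (Fin N)) : ℝ :=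
  1 / (n : ℝ) * ∑ i, (f i (y i) + inner ℝ (gradient (f i) (y i)) (agentMean y - y i))

lemma oracle_expand (y : Fin n → EuclideanSpace ℝ (Fin N))
    (z : EuclideanSpace ℝ (Fin N)) :
    oracleValue f y + inner ℝ (agentMean fun i => gradient (f i) (y i)) (z - agentMean y)
      = 1 / (n : ℝ) * ∑ i, (f i (y i) + inner ℝ (gradient (f i) (y i)) (z - y i)) := by
  have h : inner ℝ (agentMean fun i => gradient (f i) (y i)) (z - agentMean y)
      = 1 / (n : ℝ) * ∑ i, inner ℝ (gradient (f i) (y i)) (z - agentMean y) := by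
    rw [agentMean, real_inner_smul_left, sum_inner]
  rw [oracleValue, h, ← mul_add, ← Finset.sum_add_distrib]
  congr 1
  refine Finset.sum_congr rfl fun i _ => ?_
  rw [add_assoc, ← inner_add_right]
  congr 2
  abel

/-- The average of the local gradients defines an affine minorant of the objective. -/
lemma oracle_le (hc : ∀ i, ConvexOn ℝ Set.univ (f i)) (hf : ∀ i, IsLSmooth L (f i))
    (y : Fin n → EuclideanSpace ℝ (Fin N)) (z : EuclideanSpace ℝ (Fin N)) :
    oracleValue f y + inner ℝ (agentMean fun i => gradient (f i) (y i)) (z - agentMean y)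
      ≤ avgObjective f z := by
  rw [oracle_expand, avgObjective]
  gcongr with i
  exact (hc i).add_inner_gradient_le (hf i).1 _ _

/-- The quadratic upper bound for the inexact gradient: the price of inexactness is the squared
disagreement. -/
lemma le_oracle (hn : 0 < n) (hL : 0 < L) (hf : ∀ i, IsLSmooth L (f i))
    (y : Fin n → EuclideanSpace ℝ (Fin N)) (z : EuclideanSpace ℝ (Fin N)) :
    avgObjective f z ≤
      oracleValue f y + inner ℝ (agentMean fun i => gradient (f i) (y i)) (z - agentMean y)
        + L * ‖z - agentMean y‖ ^ 2 + L / n * disagreement y ^ 2 := by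
  have hn' : (0 : ℝ) < n := by positivity
  rw [oracle_expand, avgObjective]
  have h : ∀ i, f i z ≤ (f i (y i) + inner ℝ (gradient (f i) (y i)) (z - y i))
      + (L * ‖z - agentMean y‖ ^ 2 + L * ‖y i - agentMean y‖ ^ 2) := by
    intro i
    have h1 := le_add_inner_gradient (hf i).1 (hf i).2 (y i) z
    have h2 : ‖z - y i‖ ≤ ‖z - agentMean y‖ + ‖y i - agentMean y‖ := by
      rw [← norm_neg (y i - agentMean y)]
      refine le_of_eq_of_le ?_ (norm_add_le _ _)
      congr 1
      abel
    have h3 : ‖z - y i‖ ^ 2 ≤ 2 * (‖z - agentMean y‖ ^ 2 + ‖y i - agentMean y‖ ^ 2) :=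
      (pow_le_pow_left₀ (norm_nonneg _) h2 2).trans (add_sq_le)
    nlinarith
  have h4 := Finset.sum_le_sum fun i (_ : i ∈ Finset.univ) => h i
  rw [Finset.sum_add_distrib, Finset.sum_add_distrib (f := fun _ => L * _), Finset.sum_const,
    Finset.card_univ, Fintype.card_fin, nsmul_eq_mul, ← Finset.mul_sum, ← disagreement_sq] at h4
  calc _ ≤ 1 / (n : ℝ) * _ := mul_le_mul_of_nonneg_left h4 (by positivity)
    _ = _ := by field_simp; ring

end Oracle

/-! ### Step sizes -/

namespace IsAccDNGDNSC

variable {n N : ℕ} {W : Matrix (Fin n) (Fin n) ℝ} {L : ℝ}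
  {f : Fin n → EuclideanSpace ℝ (Fin N) → ℝ} {η α : ℕ → ℝ}
  {x v y s : ℕ → Fin n → EuclideanSpace ℝ (Fin N)}

lemma alpha_pos (h : IsAccDNGDNSC W L f η α x v y s) (hη : ∀ t, 0 < η t) (hL : 0 < L) (t : ℕ) :
    0 < α t := by
  cases t with
  | zero =>
    rw [h.alpha_zero]
    exact Real.sqrt_pos.2 (mul_pos (hη 0) hL)
  | succ t => exact (h.alpha_mem t).1

lemma alpha_antitone (h : IsAccDNGDNSC W L f η α x v y s) (hη : ∀ t, 0 < η t)
    (hmono : Antitone η) (hL : 0 < L) : Antitone α := by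
  refine antitone_nat_of_succ_le fun t => ?_
  refine le_of_sq_le_sq ?_ (h.alpha_pos hη hL t).le
  rw [h.alpha_succ t]
  have h1 : η (t + 1) / η t ≤ 1 := (div_le_one (hη t)).2 (hmono t.le_succ)
  have h2 : 0 ≤ η (t + 1) / η t := div_nonneg (hη _).le (hη _).le
  have h3 := h.alpha_mem t
  have h4 : η (t + 1) / η t * (1 - α (t + 1)) ≤ 1 :=
    mul_le_one₀ h1 (by linarith [h3.2]) (by linarith [h3.1])
  calc _ ≤ 1 * α t ^ 2 := by gcongr
    _ = _ := one_mul _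

/-- The ratio `α t ^ 2 / η t` is the rate at which the accelerated method converges: it loses the
factor `1 - α` in every step. -/
lemma ratio_succ (h : IsAccDNGDNSC W L f η α x v y s) (hη : ∀ t, 0 < η t) (t : ℕ) :
    α (t + 1) ^ 2 / η (t + 1) = (1 - α (t + 1)) * (α t ^ 2 / η t) := by
  rw [h.alpha_succ t]
  have := (hη t).ne'
  have := (hη (t + 1)).ne'
  field_simp

lemma ratio_antitone (h : IsAccDNGDNSC W L f η α x v y s) (hη : ∀ t, 0 < η t) :
    Antitone fun t => α t ^ 2 / η t := by
  refine antitone_nat_of_succ_le fun t => ?_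
  rw [h.ratio_succ hη t]
  have := (h.alpha_mem t).1
  have : 0 ≤ α t ^ 2 / η t := div_nonneg (sq_nonneg _) (hη t).le
  nlinarith

lemma tendsto_alpha (h : IsAccDNGDNSC W L f η α x v y s) (hη : ∀ t, 0 < η t)
    (hlim : Tendsto η atTop (nhds 0)) : Tendsto α atTop (nhds 0) := by
  have h1 : ∀ t, α t ^ 2 ≤ α 0 ^ 2 / η 0 * η t := by
    intro t
    have h2 : α t ^ 2 = α t ^ 2 / η t * η t := by
      have := (hη t).ne'
      field_simp
    rw [h2]
    exact mul_le_mul_of_nonneg_right (h.ratio_antitone hη t.zero_le) (hη t).le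
  have h2 : Tendsto (fun t => α t ^ 2) atTop (nhds 0) := by
    refine squeeze_zero (fun t => sq_nonneg _) h1 ?_
    simpa using hlim.const_mul (α 0 ^ 2 / η 0)
  have h3 := h2.sqrt
  simp only [Real.sqrt_sq_eq_abs, Real.sqrt_zero] at h3
  exact (tendsto_zero_iff_abs_tendsto_zero _).2 h3

/-- The inverse square root of the ratio `α t ^ 2 / η t`, that is `√(η t) / α t`, grows by at least
`√(η (t + 1)) / 2` in each step. -/
lemma sqrt_div_alpha_succ (h : IsAccDNGDNSC W L f η α x v y s) (hη : ∀ t, 0 < η t) (hL : 0 < L)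
    (t : ℕ) : √(η t) / α t + √(η (t + 1)) / 2 ≤ √(η (t + 1)) / α (t + 1) := by
  have ha := h.alpha_pos hη hL t
  obtain ⟨hb, hb1⟩ := h.alpha_mem t
  have hr := h.alpha_succ t
  set a := α t
  set b := α (t + 1)
  have hp := Real.sqrt_pos.2 (hη t)
  have hq := Real.sqrt_pos.2 (hη (t + 1))
  have h1 : η t = √(η t) ^ 2 := (Real.sq_sqrt (hη t).le).symm
  have h2 : η (t + 1) = √(η (t + 1)) ^ 2 := (Real.sq_sqrt (hη (t + 1)).le).symm
  rw [h1, h2] at hr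
  set p := √(η t)
  set q := √(η (t + 1))
  have h3 : (p / a) ^ 2 = (1 - b) * (q / b) ^ 2 := by
    have : b ^ 2 * p ^ 2 = q ^ 2 * (1 - b) * a ^ 2 := by
      rw [hr]; field_simp
    field_simp
    linarith
  have h4 : q / 2 = b / 2 * (q / b) := by field_simp
  have h5 : 0 < q / b := by positivity
  have h6 : p / a ≤ (1 - b / 2) * (q / b) := by
    refine le_of_sq_le_sq ?_ (mul_nonneg (by linarith) h5.le)
    rw [h3, mul_pow]
    gcongr
    nlinarith
  rw [h4]
  linarith

/-! ### Averages and disagreements along a run -/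

lemma x_succ_eq (h : IsAccDNGDNSC W L f η α x v y s) (t : ℕ) :
    x (t + 1) = mix W (y t) - η t • s t := funext (h.x_succ t)

lemma v_succ_eq (h : IsAccDNGDNSC W L f η α x v y s) (t : ℕ) :
    v (t + 1) = mix W (v t) - (η t / α t) • s t := funext (h.v_succ t)

lemma y_eq (h : IsAccDNGDNSC W L f η α x v y s) (t : ℕ) :
    y t = (1 - α t) • x t + α t • v t := by
  cases t with
  | zero =>
    ext1 i
    simp [h.x_zero, h.v_zero, h.y_zero]
  | succ t => exact funext (h.y_succ t)

lemma s_succ_eq (h : IsAccDNGDNSC W L f η α x v y s) (t : ℕ) :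
    s (t + 1) = mix W (s t) +
      ((fun i => gradient (f i) (y (t + 1) i)) - fun i => gradient (f i) (y t i)) := by
  ext1 i
  rw [h.s_succ t i, add_sub_assoc]
  rfl

lemma agentMean_y (h : IsAccDNGDNSC W L f η α x v y s) (t : ℕ) :
    agentMean (y t) = (1 - α t) • agentMean (x t) + α t • agentMean (v t) := by
  rw [h.y_eq t, agentMean_add, agentMean_smul, agentMean_smul]

/-- Gradient tracking: the average of the `s t i` is the average of the current gradients. -/
lemma agentMean_s (h : IsAccDNGDNSC W L f η α x v y s) (hW : W ∈ doublyStochastic ℝ (Fin n))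
    (hf : ∀ i, IsLSmooth L (f i)) (t : ℕ) :
    agentMean (s t) = agentMean fun i => gradient (f i) (y t i) := by
  induction t with
  | zero =>
    simp only [h.y_zero]
    rw [← gradient_avgObjective hf, funext h.s_zero]
    rcases Nat.eq_zero_or_pos n with rfl | hn
    · simp [agentMean, gradient_avgObjective hf]
    have : (n : ℝ) ≠ 0 := by positivity
    rw [agentMean, Finset.sum_const, Finset.card_univ, Fintype.card_fin,
      ← Nat.cast_smul_eq_nsmul ℝ, smul_smul, one_div_mul_cancel this, one_smul]
  | succ t ih =>
    rw [h.s_succ_eq, agentMean_add, agentMean_mix hW, agentMean_sub, ih]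
    abel

lemma agentMean_x_succ (h : IsAccDNGDNSC W L f η α x v y s) (hW : W ∈ doublyStochastic ℝ (Fin n))
    (t : ℕ) : agentMean (x (t + 1)) = agentMean (y t) - η t • agentMean (s t) := by
  rw [h.x_succ_eq, agentMean_sub, agentMean_mix hW, agentMean_smul]

lemma agentMean_v_succ (h : IsAccDNGDNSC W L f η α x v y s) (hW : W ∈ doublyStochastic ℝ (Fin n))
    (t : ℕ) : agentMean (v (t + 1)) = agentMean (v t) - (η t / α t) • agentMean (s t) := by
  rw [h.v_succ_eq, agentMean_sub, agentMean_mix hW, agentMean_smul]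

/-- The averages `x̄` are running weighted averages of the `v̄`. -/
lemma agentMean_x_succ_eq_combination (h : IsAccDNGDNSC W L f η α x v y s)
    (hW : W ∈ doublyStochastic ℝ (Fin n)) {t : ℕ} (ht : α t ≠ 0) :
    agentMean (x (t + 1)) = (1 - α t) • agentMean (x t) + α t • agentMean (v (t + 1)) := by
  rw [h.agentMean_x_succ hW, h.agentMean_v_succ hW, h.agentMean_y, smul_sub, smul_smul,
    mul_div_cancel₀ _ ht]
  abel

lemma norm_agentMean_y_succ_sub_le (h : IsAccDNGDNSC W L f η α x v y s)
    (hW : W ∈ doublyStochastic ℝ (Fin n)) (hη : ∀ t, 0 < η t) (hmono : Antitone η) (hL : 0 < L)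
    {t : ℕ} (ht : α t ≤ 1) :
    ‖agentMean (y (t + 1)) - agentMean (y t)‖
      ≤ 2 * (η t * ‖agentMean (s t)‖) + α t * ‖agentMean (v t) - agentMean (x t)‖ := by
  have ha := h.alpha_pos hη hL t
  have ha' := h.alpha_antitone hη hmono hL t.le_succ
  have ha'' := (h.alpha_mem t).1
  have hη' := hη t
  have e : agentMean (y (t + 1)) - agentMean (y t) = -(η t • agentMean (s t))
      + (α (t + 1) * (1 - α t)) • ((agentMean (v t) - agentMean (x t))
        - (η t / α t) • agentMean (s t)) := by
    rw [h.agentMean_y (t + 1), h.agentMean_x_succ hW, h.agentMean_v_succ hW, h.agentMean_y]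
    have := ha.ne'
    match_scalars <;> field_simp <;> ring
  have h1 : ‖(agentMean (v t) - agentMean (x t)) - (η t / α t) • agentMean (s t)‖
      ≤ ‖agentMean (v t) - agentMean (x t)‖ + η t / α t * ‖agentMean (s t)‖ := by
    refine (norm_sub_le _ _).trans_eq ?_
    rw [norm_smul, Real.norm_of_nonneg (by positivity)]
  have h2 : α (t + 1) * (1 - α t) ≤ α t := by nlinarith
  rw [e]
  refine (norm_add_le _ _).trans ?_
  rw [norm_neg, norm_smul, norm_smul, Real.norm_of_nonneg hη'.le,
    Real.norm_of_nonneg (mul_nonneg ha''.le (by linarith))]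
  calc _ ≤ η t * ‖agentMean (s t)‖ + α t * (‖agentMean (v t) - agentMean (x t)‖
        + η t / α t * ‖agentMean (s t)‖) := by gcongr
    _ = _ := by field_simp; ring

/-- The contraction of the disagreements, measured by a combination of those of `y`, `α v` and
`η s` whose weights `1`, `A`, `B` depend on the spectral gap `2 γ` only. In the limit of small steps
the three quantities evolve by a triangular system with diagonal entries `σ`, so that suitable
weights give a contraction by any factor above `σ`, here by the midpoint `1 - γ` of `σ` and `1`. -/
lemma disagreement_step (h : IsAccDNGDNSC W L f η α x v y s) (hn : 0 < n)
    (hW : W ∈ doublyStochastic ℝ (Fin n)) (hσ : secondSingularValue W < 1)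
    (hf : ∀ i, IsLSmooth L (f i)) (hη : ∀ t, 0 < η t) (hmono : Antitone η) (hL : 0 < L)
    {γ A B : ℝ} (hγ : γ = (1 - secondSingularValue W) / 2) (hA : A = 2 / γ) (hB : B = (4 + A) / γ)
    {t : ℕ} (ht : 2 * (B * L * η t) ≤ γ) :
    disagreement (y (t + 1)) + A * (α (t + 1) * disagreement (v (t + 1)))
        + B * (η (t + 1) * disagreement (s (t + 1)))
      ≤ (1 - γ) * (disagreement (y t) + A * (α t * disagreement (v t))
          + B * (η t * disagreement (s t)))
        + B * L * η t * (√n * ‖agentMean (y (t + 1)) - agentMean (y t)‖) := by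
  have hσ0 : 0 ≤ secondSingularValue W := LinearMap.singularValues_nonneg _ _
  have hxd := (congrArg disagreement (h.x_succ_eq t)).trans_le
    ((disagreement_sub_smul_le (hη t).le _ _).trans
      (add_le_add_left (disagreement_mix_le hn hW hσ (y t)) _))
  have ha := h.alpha_pos hη hL t
  have hvd := (congrArg disagreement (h.v_succ_eq t)).trans_le
    ((disagreement_sub_smul_le (div_nonneg (hη t).le ha.le) _ _).trans
      (add_le_add_left (disagreement_mix_le hn hW hσ (v t)) _))
  have hyd : disagreement (y (t + 1)) ≤ (1 - α (t + 1)) * disagreement (x (t + 1))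
      + α (t + 1) * disagreement (v (t + 1)) := by
    have hm := h.alpha_mem t
    rw [h.y_eq (t + 1)]
    refine (disagreement_add_le _ _).trans_eq ?_
    rw [disagreement_smul, disagreement_smul, abs_of_pos hm.1, abs_of_pos (by linarith [hm.2])]
  have hgd : stackNorm ((fun i => gradient (f i) (y (t + 1) i)) - fun i => gradient (f i) (y t i))
      ≤ L * stackNorm (y (t + 1) - y t) := stackNorm_le_mul hL.le fun i => (hf i).2 _ _
  have hsd : disagreement (s (t + 1)) ≤ secondSingularValue W * disagreement (s t)
      + L * (disagreement (y (t + 1)) + disagreement (y t)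
        + √n * ‖agentMean (y (t + 1)) - agentMean (y t)‖) := by
    rw [h.s_succ_eq]
    refine (disagreement_add_le _ _).trans (add_le_add (disagreement_mix_le hn hW hσ _) ?_)
    refine (disagreement_le_stackNorm hn _).trans (hgd.trans ?_)
    gcongr
    exact stackNorm_sub_le _ _
  have hm := h.alpha_mem t
  have ha' := h.alpha_antitone hη hmono hL t.le_succ
  have hη' := hmono t.le_succ
  have hη0 := hη t
  have hY := disagreement_nonneg (y t)
  have hY' := disagreement_nonneg (y (t + 1))
  have hX' := disagreement_nonneg (x (t + 1))
  have hV := disagreement_nonneg (v t)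
  have hV' := disagreement_nonneg (v (t + 1))
  have hS := disagreement_nonneg (s t)
  have hS' := disagreement_nonneg (s (t + 1))
  set σ := secondSingularValue W
  set D := √n * ‖agentMean (y (t + 1)) - agentMean (y t)‖
  set p := α t * disagreement (v t) with hp
  set q := η t * disagreement (s t) with hq
  have hγ0 : 0 < γ := by rw [hγ]; linarith
  have hA0 : 0 < A := by rw [hA]; positivity
  have hB0 : 0 < B := by rw [hB]; positivity
  have hp0 : 0 ≤ p := mul_nonneg ha.le hV
  have hq0 : 0 ≤ q := mul_nonneg hη0.le hS
  have hp' : α (t + 1) * disagreement (v (t + 1)) ≤ σ * p + q := by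
    calc _ ≤ α t * (σ * disagreement (v t) + η t / α t * disagreement (s t)) := by gcongr
      _ = _ := by rw [hp, hq]; field_simp
  have hy' : disagreement (y (t + 1)) ≤ σ * disagreement (y t) + σ * p + 2 * q := by
    have h1 : (1 - α (t + 1)) * disagreement (x (t + 1)) ≤ disagreement (x (t + 1)) := by
      nlinarith [hm.1]
    linarith
  have hq' : η (t + 1) * disagreement (s (t + 1)) ≤
      σ * q + L * η t * (disagreement (y (t + 1)) + disagreement (y t) + D) := by
    calc _ ≤ η t * (σ * disagreement (s t)
          + L * (disagreement (y (t + 1)) + disagreement (y t) + D)) := by gcongr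
      _ = _ := by rw [hq]; ring
  set k := B * L * η t
  have hk0 : 0 ≤ k := by positivity
  have hAγ : A * γ = 2 := by rw [hA]; field_simp
  have hBγ : B * γ = 4 + A := by rw [hB]; field_simp
  have hσγ : σ = 1 - 2 * γ := by rw [hγ]; ring
  have h1 : (1 + k) * disagreement (y (t + 1))
      ≤ (1 + k) * (σ * disagreement (y t) + σ * p + 2 * q) := by gcongr
  have h2 : A * (α (t + 1) * disagreement (v (t + 1))) ≤ A * (σ * p + q) := by gcongr
  have h3 : B * (η (t + 1) * disagreement (s (t + 1))) ≤
      B * σ * q + k * disagreement (y (t + 1)) + k * disagreement (y t) + k * D := by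
    calc _ ≤ B * (σ * q + L * η t * (disagreement (y (t + 1)) + disagreement (y t) + D)) := by
          gcongr
      _ = _ := by simp only [k]; ring
  have hk1 : k ≤ 1 := by linarith
  have hσ1 : σ ≤ 1 := hσ.le
  have hkσ : k * σ ≤ k := mul_le_of_le_one_right hk0 hσ1
  have hAσ : A * σ = A - 4 := by rw [hσγ]; linear_combination (-2) * hAγ
  have hBσ : B * σ = B - 2 * (4 + A) := by rw [hσγ]; linear_combination (-2) * hBγ
  -- the three coefficients after the step are at most `1 - γ` times those before it
  have c1 : ((1 + k) * σ + k) * disagreement (y t) ≤ (1 - γ) * disagreement (y t) :=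
    mul_le_mul_of_nonneg_right (by linarith) hY
  have c2 : ((1 + k) * σ + A * σ) * p ≤ ((1 - γ) * A) * p :=
    mul_le_mul_of_nonneg_right (by linarith) hp0
  have c3 : ((1 + k) * 2 + A + B * σ) * q ≤ ((1 - γ) * B) * q :=
    mul_le_mul_of_nonneg_right (by linarith) hq0
  have e1 : disagreement (y (t + 1)) + A * (α (t + 1) * disagreement (v (t + 1)))
      + B * (η (t + 1) * disagreement (s (t + 1)))
      ≤ ((1 + k) * σ + k) * disagreement (y t) + ((1 + k) * σ + A * σ) * p
        + ((1 + k) * 2 + A + B * σ) * q + k * D := by linear_combination h1 + h2 + h3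
  linear_combination e1 + c1 + c2 + c3

/-! ### One step of the accelerated method -/

/-- The estimate-sequence inequality of the accelerated gradient method with inexact gradients. -/
lemma objective_step (h : IsAccDNGDNSC W L f η α x v y s) (hn : 0 < n)
    (hW : W ∈ doublyStochastic ℝ (Fin n)) (hc : ∀ i, ConvexOn ℝ Set.univ (f i))
    (hf : ∀ i, IsLSmooth L (f i)) (hη : ∀ t, 0 < η t) (hL : 0 < L)
    (z : EuclideanSpace ℝ (Fin N)) {t : ℕ} (ht : α t ≤ 1) :
    avgObjective f (agentMean (x (t + 1))) - avgObjective f z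
        + α t ^ 2 / η t / 2 * ‖agentMean (v (t + 1)) - z‖ ^ 2
      ≤ (1 - α t) * (avgObjective f (agentMean (x t)) - avgObjective f z)
        + α t ^ 2 / η t / 2 * ‖agentMean (v t) - z‖ ^ 2
        - η t * (1 / 2 - L * η t) * ‖agentMean (s t)‖ ^ 2 + L / n * disagreement (y t) ^ 2 := by
  have ha := h.alpha_pos hη hL t
  have hη0 := hη t
  have h1 := le_oracle hn hL hf (y t) (agentMean (x (t + 1)))
  have h2 := oracle_le hc hf (y t) z
  have h3 := oracle_le hc hf (y t) (agentMean (x t))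
  rw [← h.agentMean_s hW hf] at h1 h2 h3
  rw [h.agentMean_x_succ hW] at h1 ⊢
  rw [h.agentMean_v_succ hW]
  rw [sub_sub_cancel_left, inner_neg_right, inner_smul_right, real_inner_self_eq_norm_sq, norm_neg,
    norm_smul, Real.norm_of_nonneg hη0.le, mul_pow] at h1
  have h4 : inner ℝ (agentMean (s t)) (agentMean (v t) - z) * α t
      = -(α t * inner ℝ (agentMean (s t)) (z - agentMean (y t))
        + (1 - α t) * inner ℝ (agentMean (s t)) (agentMean (x t) - agentMean (y t))) := by
    rw [h.agentMean_y]
    simp only [inner_sub_right, inner_add_right, inner_smul_right]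
    ring
  have h5 : ‖agentMean (v t) - (η t / α t) • agentMean (s t) - z‖ ^ 2
      = ‖agentMean (v t) - z‖ ^ 2
        - 2 * (η t / α t) * inner ℝ (agentMean (s t)) (agentMean (v t) - z)
        + (η t / α t) ^ 2 * ‖agentMean (s t)‖ ^ 2 := by
    rw [sub_right_comm, norm_sub_sq_real, inner_smul_right, norm_smul,
      Real.norm_of_nonneg (by positivity), mul_pow, real_inner_comm]
    ring
  have h6 : α t ^ 2 / η t / 2 * ‖agentMean (v t) - (η t / α t) • agentMean (s t) - z‖ ^ 2
      = α t ^ 2 / η t / 2 * ‖agentMean (v t) - z‖ ^ 2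
        - inner ℝ (agentMean (s t)) (agentMean (v t) - z) * α t
        + η t / 2 * ‖agentMean (s t)‖ ^ 2 := by
    rw [h5]
    field_simp
  rw [h6, h4]
  nlinarith [mul_le_mul_of_nonneg_left h2 ha.le, mul_le_mul_of_nonneg_left h3 (sub_nonneg.2 ht)]

end IsAccDNGDNSC

/-! ### The perturbed energy -/

/-- A bootstrap argument: `Ψ` may grow by a summable multiple of `(p + q) ^ 2`, where `Ψ` controls
`q`, and `p` never exceeds the larger of its previous value and the current `q`. -/
lemma exists_forall_le_of_perturbed {Ψ p q c : ℕ → ℝ} (hc0 : ∀ k, 0 ≤ c k) (hc : Summable c)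
    (hp : ∀ k, 0 ≤ p k) (hqΨ : ∀ k, q k ^ 2 ≤ 2 * Ψ k)
    (hpq : ∀ k, p (k + 1) ≤ max (p k) (q (k + 1)))
    (hΨ : ∀ k, Ψ (k + 1) ≤ Ψ k + c k * (p k + q k) ^ 2) :
    ∃ S, 0 ≤ S ∧ ∀ k, Ψ k ≤ S := by
  set S₀ := max (Ψ 0) (p 0 ^ 2)
  have hS₀ : 0 ≤ S₀ := (sq_nonneg _).trans (le_max_right _ _)
  have key : ∀ k, Ψ k ≤ S₀ * Real.exp (8 * ∑ j ∈ Finset.range k, c j) ∧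
      p k ^ 2 ≤ 2 * (S₀ * Real.exp (8 * ∑ j ∈ Finset.range k, c j)) := by
    intro k
    induction k with
    | zero =>
      have h1 : Ψ 0 ≤ S₀ := le_max_left _ _
      have h2 : p 0 ^ 2 ≤ S₀ := le_max_right _ _
      simp only [Finset.range_zero, Finset.sum_empty, mul_zero, Real.exp_zero, mul_one]
      exact ⟨h1, by linarith⟩
    | succ k ih =>
      obtain ⟨ih1, ih2⟩ := ih
      set S := S₀ * Real.exp (8 * ∑ j ∈ Finset.range k, c j)
      have hS : 0 ≤ S := by positivity
      have e : S₀ * Real.exp (8 * ∑ j ∈ Finset.range (k + 1), c j) = S * Real.exp (8 * c k) := by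
        rw [Finset.sum_range_succ, mul_add, Real.exp_add, mul_assoc]
      rw [e]
      have h1 : S * (8 * c k + 1) ≤ S * Real.exp (8 * c k) := by
        gcongr
        exact Real.add_one_le_exp _
      have h2 : (p k + q k) ^ 2 ≤ 8 * S := by
        have := add_sq_le (a := p k) (b := q k)
        have := hqΨ k
        linarith
      have h3 : Ψ (k + 1) ≤ S * Real.exp (8 * c k) := by
        have := mul_le_mul_of_nonneg_left h2 (hc0 k)
        have := hΨ k
        linarith
      refine ⟨h3, ?_⟩
      rcases le_max_iff.1 (hpq k) with h4 | h4
      · have := pow_le_pow_left₀ (hp _) h4 2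
        nlinarith [mul_nonneg hS (hc0 k)]
      · have := pow_le_pow_left₀ (hp _) h4 2
        have := hqΨ (k + 1)
        linarith
  refine ⟨S₀ * Real.exp (8 * ∑' j, c j), by positivity, fun k => (key k).1.trans ?_⟩
  gcongr
  exact hc.sum_le_tsum _ fun j _ => hc0 j

namespace IsAccDNGDNSC

variable {n N : ℕ} {W : Matrix (Fin n) (Fin n) ℝ} {L : ℝ}
  {f : Fin n → EuclideanSpace ℝ (Fin N) → ℝ} {η α : ℕ → ℝ}
  {x v y s : ℕ → Fin n → EuclideanSpace ℝ (Fin N)}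

/-- The inequality `objective_step` with the squared disagreement `V ^ 2` added to the energy: for
small steps, the gain `η ‖s̄‖ ^ 2 / 2` and the contraction of `V` absorb all error terms except the
one with `v̄ - x̄`. The weight of `V ^ 2` is such that half of its contraction pays for the error
`L / n * disagreement (y t) ^ 2` of the inexact gradient. -/
lemma energy_step (h : IsAccDNGDNSC W L f η α x v y s) (hn : 0 < n)
    (hW : W ∈ doublyStochastic ℝ (Fin n)) (hc : ∀ i, ConvexOn ℝ Set.univ (f i))
    (hf : ∀ i, IsLSmooth L (f i)) (hη : ∀ t, 0 < η t) (hmono : Antitone η) (hL : 0 < L)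
    (z : EuclideanSpace ℝ (Fin N)) {V : ℕ → ℝ} {γ B : ℝ} (hγ0 : 0 < γ) (hγ1 : γ ≤ 1)
    (hV : ∀ t, disagreement (y t) ≤ V t) {t : ℕ}
    (hstep : V (t + 1) ≤ (1 - γ) * V t
      + B * L * η t * (√n * ‖agentMean (y (t + 1)) - agentMean (y t)‖))
    (hα : α t ≤ γ / 2) (hLη : 4 * (L * η t) ≤ 1)
    (hMη : 64 * (B ^ 2 * L ^ 3 / γ ^ 2 * η t ^ 3) ≤ 1) :
    avgObjective f (agentMean (x (t + 1))) - avgObjective f z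
        + 2 * L / (n * γ) * V (t + 1) ^ 2 + α t ^ 2 / η t / 2 * ‖agentMean (v (t + 1)) - z‖ ^ 2
      ≤ (1 - α t) * (avgObjective f (agentMean (x t)) - avgObjective f z
          + 2 * L / (n * γ) * V t ^ 2)
        + α t ^ 2 / η t / 2 * ‖agentMean (v t) - z‖ ^ 2
        + 4 * (B ^ 2 * L ^ 3 / γ ^ 2) * η t ^ 2 *
          (α t ^ 2 * ‖agentMean (v t) - agentMean (x t)‖ ^ 2) := by
  have hn' : (0 : ℝ) < n := by positivity
  have hη0 := hη t
  have h1 := h.objective_step hn hW hc hf hη hL z (t := t) (by linarith)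
  have hd := h.norm_agentMean_y_succ_sub_le hW hη hmono hL (t := t) (by linarith)
  set d := ‖agentMean (y (t + 1)) - agentMean (y t)‖
  set g := ‖agentMean (s t)‖
  set w := ‖agentMean (v t) - agentMean (x t)‖
  have hd0 : 0 ≤ d := norm_nonneg _
  have hd2 : d ^ 2 ≤ 8 * (η t ^ 2 * g ^ 2) + 2 * (α t ^ 2 * w ^ 2) := by
    refine (pow_le_pow_left₀ hd0 hd 2).trans (add_sq_le.trans_eq ?_)
    ring
  have hVt0 : 0 ≤ V t := (disagreement_nonneg _).trans (hV t)
  have hVt : disagreement (y t) ^ 2 ≤ V t ^ 2 :=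
    pow_le_pow_left₀ (disagreement_nonneg _) (hV t) 2
  -- convexity of the square, with weights `1 - γ` and `γ`
  have hV2 : V (t + 1) ^ 2 ≤ (1 - γ) * V t ^ 2 + (B * L * η t) ^ 2 * n * d ^ 2 / γ := by
    have h0 : 0 ≤ V (t + 1) := (disagreement_nonneg _).trans (hV (t + 1))
    set m := B * L * η t * (√n * d)
    have hm : m ^ 2 = (B * L * η t) ^ 2 * n * d ^ 2 := by
      rw [mul_pow, mul_pow √n, Real.sq_sqrt hn'.le]; ring
    rw [← hm]
    refine (pow_le_pow_left₀ h0 hstep 2).trans ?_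
    have e : (1 - γ) * V t ^ 2 + m ^ 2 / γ - ((1 - γ) * V t + m) ^ 2
        = (1 - γ) * (γ * V t - m) ^ 2 / γ := by
      field_simp
      ring
    have : 0 ≤ (1 - γ) * (γ * V t - m) ^ 2 / γ :=
      div_nonneg (mul_nonneg (by linarith) (sq_nonneg _)) hγ0.le
    linarith
  set M := B ^ 2 * L ^ 3 / γ ^ 2
  have h2 : 2 * L / (n * γ) * V (t + 1) ^ 2 ≤ 2 * L / (n * γ) * ((1 - γ) * V t ^ 2)
      + 2 * M * η t ^ 2 * d ^ 2 := by
    calc _ ≤ 2 * L / (n * γ) * ((1 - γ) * V t ^ 2 + (B * L * η t) ^ 2 * n * d ^ 2 / γ) := by gcongr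
      _ = _ := by simp only [M]; field_simp
  have hM0 : 0 ≤ M := by positivity
  have h3 : 2 * M * η t ^ 2 * d ^ 2
      ≤ 2 * M * η t ^ 2 * (8 * (η t ^ 2 * g ^ 2) + 2 * (α t ^ 2 * w ^ 2)) := by gcongr
  have h4 : 2 * L / (n * γ) * ((1 - γ) * V t ^ 2) + L / n * disagreement (y t) ^ 2
      ≤ (1 - α t) * (2 * L / (n * γ) * V t ^ 2) := by
    have e : 2 * L / (n * γ) * γ = 2 * (L / n) := by field_simp
    have e1 : L / n * disagreement (y t) ^ 2 ≤ L / n * V t ^ 2 := by gcongr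
    have e2 : 2 * L / (n * γ) * V t ^ 2 * α t ≤ 2 * L / (n * γ) * V t ^ 2 * (γ / 2) := by gcongr
    linear_combination e1 + e2 - (V t ^ 2 / 2) * e
  have h5 : 16 * M * η t ^ 4 * g ^ 2 ≤ η t * (1 / 2 - L * η t) * g ^ 2 := by
    refine mul_le_mul_of_nonneg_right ?_ (sq_nonneg g)
    have i1 := mul_le_mul_of_nonneg_left hMη hη0.le
    have i2 := mul_le_mul_of_nonneg_left hLη hη0.le
    linear_combination i1 / 4 + i2 / 4
  linear_combination h1 + h2 + h3 + h4 + h5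

/-- Up to a constant, the gap of `f (x̄ t)` to the minimum and the squared disagreement converge at
the rate `α ^ 2 / η` of the accelerated method. -/
lemma exists_energy_bound (h : IsAccDNGDNSC W L f η α x v y s) (hn : 0 < n)
    (hW : W ∈ doublyStochastic ℝ (Fin n)) (hσ : secondSingularValue W < 1)
    (hc : ∀ i, ConvexOn ℝ Set.univ (f i)) (hf : ∀ i, IsLSmooth L (f i)) (hη : ∀ t, 0 < η t)
    (hmono : Antitone η) (hlim : Tendsto η atTop (nhds 0)) (hsum : Summable fun t => η t ^ 3)
    (hL : 0 < L) {z : EuclideanSpace ℝ (Fin N)} (hz : ∀ a, avgObjective f z ≤ avgObjective f a) :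
    ∃ C, 0 ≤ C ∧ ∀ᶠ t in atTop,
      avgObjective f (agentMean (x (t + 1))) - avgObjective f z ≤ C * (α t ^ 2 / η t) ∧
      disagreement (y (t + 1)) ^ 2 ≤ C * (α t ^ 2 / η t) := by
  have hσ0 : 0 ≤ secondSingularValue W := LinearMap.singularValues_nonneg _ _
  have hn' : (0 : ℝ) < n := by positivity
  obtain ⟨γ, hγ⟩ : ∃ γ, γ = (1 - secondSingularValue W) / 2 := ⟨_, rfl⟩
  obtain ⟨A, hA⟩ : ∃ A, A = 2 / γ := ⟨_, rfl⟩
  obtain ⟨B, hB⟩ : ∃ B, B = (4 + A) / γ := ⟨_, rfl⟩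
  have hγ0 : 0 < γ := by linarith
  have hA0 : 0 < A := by rw [hA]; positivity
  have hB0 : 0 < B := by rw [hB]; positivity
  set V : ℕ → ℝ := fun t => disagreement (y t) + A * (α t * disagreement (v t))
    + B * (η t * disagreement (s t))
  have hα0 := h.alpha_pos hη hL
  have hV : ∀ t, disagreement (y t) ≤ V t := by
    intro t
    have := mul_nonneg hA0.le (mul_nonneg (hα0 t).le (disagreement_nonneg (v t)))
    have := mul_nonneg hB0.le (mul_nonneg (hη t).le (disagreement_nonneg (s t)))
    simp only [V]
    linarith
  have hsmall : ∀ᶠ t in atTop, 2 * (B * L * η t) ≤ γ ∧ α t ≤ γ / 2 ∧ 4 * (L * η t) ≤ 1 ∧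
      64 * (B ^ 2 * L ^ 3 / γ ^ 2 * η t ^ 3) ≤ 1 := by
    refine Eventually.and ?_ (Eventually.and ?_ (Eventually.and ?_ ?_))
    · have := (hlim.const_mul (B * L)).const_mul 2
      rw [mul_zero, mul_zero] at this
      exact this.eventually_le_const hγ0
    · exact (h.tendsto_alpha hη hlim).eventually_le_const (by positivity)
    · have := (hlim.const_mul L).const_mul 4
      rw [mul_zero, mul_zero] at this
      exact this.eventually_le_const one_pos
    · have := ((hlim.pow 3).const_mul (B ^ 2 * L ^ 3 / γ ^ 2)).const_mul 64
      rw [zero_pow three_ne_zero, mul_zero, mul_zero] at this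
      exact this.eventually_le_const one_pos
  obtain ⟨T, hT⟩ := eventually_atTop.1 hsmall
  set P := 2 * L / (n * γ)
  have hP0 : 0 < P := by positivity
  set c := 4 * (B ^ 2 * L ^ 3 / γ ^ 2)
  have hc0 : 0 ≤ c := by positivity
  have hr : ∀ t, 0 < α t ^ 2 / η t := fun t => div_pos (pow_pos (hα0 t) 2) (hη t)
  have hgap : ∀ t, 0 ≤ avgObjective f (agentMean (x t)) - avgObjective f z :=
    fun t => sub_nonneg.2 (hz _)
  -- the energy divided by the rate `α ^ 2 / η`
  set Ψ : ℕ → ℝ := fun t => (avgObjective f (agentMean (x (t + 1))) - avgObjective f z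
    + P * V (t + 1) ^ 2) / (α t ^ 2 / η t) + ‖agentMean (v (t + 1)) - z‖ ^ 2 / 2 with hΨ
  have hΨstep : ∀ t, T ≤ t → Ψ (t + 1) ≤ Ψ t + c * η (t + 1) ^ 3 *
      (‖agentMean (x (t + 1)) - z‖ + ‖agentMean (v (t + 1)) - z‖) ^ 2 := by
    intro t ht
    obtain ⟨h1, h2, h3, h4⟩ := hT (t + 1) (by omega)
    have hs := h.energy_step hn hW hc hf hη hmono hL z hγ0 (by linarith) hV
      (h.disagreement_step hn hW hσ hf hη hmono hL hγ hA hB h1) h2 h3 h4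
    have hw : ‖agentMean (v (t + 1)) - agentMean (x (t + 1))‖
        ≤ ‖agentMean (x (t + 1)) - z‖ + ‖agentMean (v (t + 1)) - z‖ := by
      rw [← norm_neg (agentMean (x (t + 1)) - z), add_comm]
      refine le_of_eq_of_le ?_ (norm_add_le _ _)
      congr 1
      abel
    have hw2 := pow_le_pow_left₀ (norm_nonneg _) hw 2
    have hr' := hr (t + 1)
    have hα2 : α (t + 1) ^ 2 = α (t + 1) ^ 2 / η (t + 1) * η (t + 1) := by
      have := (hη (t + 1)).ne'
      field_simp
    have hq := h.ratio_succ hη t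
    have hrt := hr t
    set r := α (t + 1) ^ 2 / η (t + 1)
    rw [hα2] at hs
    set X := avgObjective f (agentMean (x (t + 1))) - avgObjective f z + P * V (t + 1) ^ 2
    have hX : (1 - α (t + 1)) * X = r * (X / (α t ^ 2 / η t)) := by
      rw [hq, mul_assoc, mul_div_cancel₀ _ hrt.ne']
    rw [hX] at hs
    refine le_of_mul_le_mul_left ?_ hr'
    have e : r * Ψ (t + 1) = avgObjective f (agentMean (x (t + 1 + 1))) - avgObjective f z
        + P * V (t + 1 + 1) ^ 2 + r / 2 * ‖agentMean (v (t + 1 + 1)) - z‖ ^ 2 := by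
      simp only [hΨ]
      rw [mul_add, mul_div_cancel₀ _ hr'.ne']
      ring
    have e2 : r * Ψ t = r * (X / (α t ^ 2 / η t)) + r / 2 * ‖agentMean (v (t + 1)) - z‖ ^ 2 := by
      simp only [hΨ]
      ring
    rw [e, mul_add, e2]
    have e3 := mul_le_mul_of_nonneg_left hw2
      (mul_nonneg (mul_nonneg hc0 hr'.le) (pow_nonneg (hη (t + 1)).le 3))
    linear_combination hs + e3
  obtain ⟨S, hS0, hS⟩ := exists_forall_le_of_perturbed
    (Ψ := fun k => Ψ (k + T)) (p := fun k => ‖agentMean (x (k + T + 1)) - z‖)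
    (q := fun k => ‖agentMean (v (k + T + 1)) - z‖) (c := fun k => c * η (k + T + 1) ^ 3)
    (fun k => mul_nonneg hc0 (pow_nonneg (hη _).le 3))
    (((summable_nat_add_iff (T + 1)).2 hsum).mul_left c)
    (fun k => norm_nonneg _)
    (fun k => by
      have := div_nonneg (add_nonneg (hgap (k + T + 1))
        (mul_nonneg hP0.le (sq_nonneg (V (k + T + 1))))) (hr (k + T)).le
      simp only [hΨ]
      linarith)
    -- `x̄` is a convex combination of its previous value and the current `v̄`
    (fun k => by
      have e : k + 1 + T = k + T + 1 := by ring
      simp only [e]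
      obtain ⟨hm, hm1⟩ := h.alpha_mem (k + T)
      rw [h.agentMean_x_succ_eq_combination hW hm.ne']
      have e2 : (1 - α (k + T + 1)) • agentMean (x (k + T + 1))
          + α (k + T + 1) • agentMean (v (k + T + 1 + 1)) - z
          = (1 - α (k + T + 1)) • (agentMean (x (k + T + 1)) - z)
          + α (k + T + 1) • (agentMean (v (k + T + 1 + 1)) - z) := by
        module
      rw [e2]
      refine (norm_add_le _ _).trans ?_
      rw [norm_smul, norm_smul, Real.norm_of_nonneg hm.le, Real.norm_of_nonneg (by linarith)]
      have i1 := le_max_left ‖agentMean (x (k + T + 1)) - z‖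
        ‖agentMean (v (k + T + 1 + 1)) - z‖
      have i2 := le_max_right ‖agentMean (x (k + T + 1)) - z‖
        ‖agentMean (v (k + T + 1 + 1)) - z‖
      nlinarith)
    (fun k => by
      have e : k + 1 + T = k + T + 1 := by ring
      simp only [e]
      exact hΨstep (k + T) (by omega))
  refine ⟨S + S / P, by positivity, eventually_atTop.2 ⟨T, fun t ht => ?_⟩⟩
  have h1 := hS (t - T)
  simp only [Nat.sub_add_cancel ht, hΨ] at h1
  have hrt := hr t
  have h2 : avgObjective f (agentMean (x (t + 1))) - avgObjective f z + P * V (t + 1) ^ 2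
      ≤ S * (α t ^ 2 / η t) := by
    rw [← div_le_iff₀ hrt]
    have := sq_nonneg ‖agentMean (v (t + 1)) - z‖
    linarith
  have hV2 : 0 ≤ P * V (t + 1) ^ 2 := by positivity
  have hSP : 0 ≤ S / P * (α t ^ 2 / η t) := by positivity
  have hSr : 0 ≤ S * (α t ^ 2 / η t) := by positivity
  rw [add_mul]
  constructor
  · linarith
  · have h3 : V (t + 1) ^ 2 ≤ S / P * (α t ^ 2 / η t) := by
      rw [div_mul_eq_mul_div, le_div_iff₀ hP0]
      linarith [hgap (t + 1)]
    have := pow_le_pow_left₀ (disagreement_nonneg _) (hV (t + 1)) 2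
    linarith

/-- The gap at an individual `y t i` in terms of the gap at the next `x̄` and the disagreement. -/
lemma objective_y_le (h : IsAccDNGDNSC W L f η α x v y s) (hn : 0 < n)
    (hW : W ∈ doublyStochastic ℝ (Fin n)) (hc : ∀ i, ConvexOn ℝ Set.univ (f i))
    (hf : ∀ i, IsLSmooth L (f i)) (hη : ∀ t, 0 < η t) (hL : 0 < L)
    {z : EuclideanSpace ℝ (Fin N)} (hz : ∀ a, avgObjective f z ≤ avgObjective f a) {t : ℕ}
    (hLη : 8 * (L * η t) ≤ 1) (i : Fin n) :
    avgObjective f (y t i) - avgObjective f z ≤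
      (1 + L) * (2 * (avgObjective f (agentMean (x (t + 1))) - avgObjective f z)
        + (1 + L) * disagreement (y t) ^ 2) := by
  have hn1 : (1 : ℝ) ≤ n := by exact_mod_cast hn
  have hη0 := hη t
  have hdiff := differentiable_avgObjective hf
  have hlip := norm_gradient_avgObjective_sub_le hn hL hf
  have hG := norm_gradient_sq_le hL hdiff hlip hz (agentMean (y t))
  have h1 := (convexOn_avgObjective hc).add_inner_gradient_le hdiff (agentMean (y t))
    (agentMean (x (t + 1)))
  have h2 := le_add_inner_gradient hdiff hlip (agentMean (y t)) (y t i)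
  have he := card_mul_norm_agentMean_gradient_sub_sq_le hn hL hf (y t) (fun _ => agentMean (y t))
  rw [← gradient_avgObjective hf, ← h.agentMean_s hW hf] at he
  have hdis : stackNorm (y t - fun _ => agentMean (y t)) = disagreement (y t) := rfl
  rw [hdis] at he
  rw [h.agentMean_x_succ hW, sub_sub_cancel_left, inner_neg_right, inner_smul_right,
    ← h.agentMean_x_succ hW] at h1
  have hδ := pow_le_pow_left₀ (norm_nonneg _) (norm_sub_agentMean_le (y t) i) 2
  set G := gradient (avgObjective f) (agentMean (y t))
  set g := agentMean (s t)
  set D := disagreement (y t) ^ 2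
  have he' : ‖g - G‖ ^ 2 ≤ L ^ 2 * D := by
    nlinarith [sq_nonneg ‖g - G‖]
  have h3 : inner ℝ G g ≤ 2 * ‖G‖ ^ 2 + L ^ 2 * D := by
    have e : inner ℝ G g = ‖G‖ ^ 2 + inner ℝ G (g - G) := by
      rw [inner_sub_right, real_inner_self_eq_norm_sq]; ring
    have := real_inner_le_norm G (g - G)
    nlinarith [sq_nonneg (‖G‖ - ‖g - G‖), sq_nonneg ‖G‖, sq_nonneg ‖g - G‖]
  have h4 : inner ℝ G (y t i - agentMean (y t)) ≤ ‖G‖ ^ 2 / 2 + D / 2 := by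
    have := real_inner_le_norm G (y t i - agentMean (y t))
    nlinarith [sq_nonneg (‖G‖ - ‖y t i - agentMean (y t)‖)]
  have h5 : η t * inner ℝ G g ≤ η t * (2 * ‖G‖ ^ 2 + L ^ 2 * D) := by gcongr
  have h6 : η t * ‖G‖ ^ 2 ≤ η t * (2 * L * (avgObjective f (agentMean (y t)) - avgObjective f z)) :=
    by gcongr
  have hφ := hz (agentMean (y t))
  set φ := avgObjective f (agentMean (y t)) - avgObjective f z with hφdef
  have hφ0 : 0 ≤ φ := sub_nonneg.2 hφ
  have hD0 : 0 ≤ D := sq_nonneg _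
  have h7 : L * η t * φ ≤ 1 / 8 * φ := by gcongr; linarith
  have h8 : L * η t * (L * D) ≤ 1 / 8 * (L * D) := by gcongr; linarith
  -- the gap at `ȳ` is at most twice the gap at the next `x̄`, up to the disagreement
  have h9 : φ ≤ 2 * (avgObjective f (agentMean (x (t + 1))) - avgObjective f z) + L * D / 4 := by
    linarith
  have h10 : L / 2 * ‖y t i - agentMean (y t)‖ ^ 2 ≤ L / 2 * D := by gcongr
  have h11 : avgObjective f (y t i) - avgObjective f z ≤ (1 + L) * (φ + D / 2) := by
    linarith
  refine h11.trans (mul_le_mul_of_nonneg_left ?_ (by positivity))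
  linarith [mul_nonneg hL.le hD0]

/-- `α` decays at least like `2 / t`, whatever the (nonincreasing) step sizes. -/
lemma mul_alpha_le (h : IsAccDNGDNSC W L f η α x v y s) (hη : ∀ t, 0 < η t) (hmono : Antitone η)
    (hL : 0 < L) (t : ℕ) : t * α t ≤ 2 := by
  have hα0 := h.alpha_pos hη hL
  have key : (t : ℝ) / 2 * √(η t) ≤ √(η t) / α t := by
    induction t with
    | zero => simpa using div_nonneg (Real.sqrt_nonneg _) (hα0 0).le
    | succ t ih =>
      refine le_trans ?_ (h.sqrt_div_alpha_succ hη hL t)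
      have := Real.sqrt_le_sqrt (hmono t.le_succ)
      have h1 : (t : ℝ) / 2 * √(η (t + 1)) ≤ (t : ℝ) / 2 * √(η t) := by gcongr
      push_cast
      linarith
  have hs := Real.sqrt_pos.2 (hη t)
  rw [le_div_iff₀ (hα0 t)] at key
  have : √(η t) * (t * α t) ≤ √(η t) * 2 := by linarith
  exact le_of_mul_le_mul_left this hs

end IsAccDNGDNSC

/-! ### Polynomially decaying step sizes -/

section Rate

variable {η β t₀ : ℝ}

lemma antitone_polynomial_step (hη : 0 < η) (hβ : 0 < β) (ht₀ : 1 ≤ t₀) :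
    Antitone fun t : ℕ => η / ((t : ℝ) + t₀) ^ β := by
  intro a b hab
  have : (a : ℝ) ≤ b := by exact_mod_cast hab
  dsimp only
  gcongr

lemma tendsto_polynomial_step (hβ : 0 < β) :
    Tendsto (fun t : ℕ => η / ((t : ℝ) + t₀) ^ β) atTop (nhds 0) :=
  ((tendsto_rpow_atTop hβ).comp
    (tendsto_atTop_add_const_right _ t₀ tendsto_natCast_atTop_atTop)).const_div_atTop η

lemma summable_polynomial_step_pow (hβ : 1 / 3 < β) (ht₀ : 1 ≤ t₀) :
    Summable fun t : ℕ => (η / ((t : ℝ) + t₀) ^ β) ^ 3 := by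
  have h := ((Real.summable_one_div_nat_add_rpow t₀ (β * 3)).2 (by linarith)).mul_left (η ^ 3)
  refine h.congr fun t => ?_
  have ht : (0 : ℝ) < t + t₀ := by positivity
  rw [abs_of_pos ht, div_pow, ← Real.rpow_mul_natCast ht.le]
  push_cast
  ring

lemma IsAccDNGDNSC.ratio_le {n N : ℕ} {W : Matrix (Fin n) (Fin n) ℝ} {L : ℝ}
    {f : Fin n → EuclideanSpace ℝ (Fin N) → ℝ} {α : ℕ → ℝ}
    {x v y s : ℕ → Fin n → EuclideanSpace ℝ (Fin N)}
    (h : IsAccDNGDNSC W L f (fun t => η / ((t : ℝ) + t₀) ^ β) α x v y s) (hη : 0 < η)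
    (hβ : 0 < β) (ht₀ : 1 ≤ t₀) (hL : 0 < L) {t : ℕ} (ht : 1 ≤ t) :
    α t ^ 2 / (η / ((t : ℝ) + t₀) ^ β)
      ≤ 16 * t₀ ^ β / η * (1 / ((t + 1 : ℕ) : ℝ) ^ (2 - β)) := by
  have hpos : ∀ t : ℕ, 0 < η / ((t : ℝ) + t₀) ^ β := fun t => by positivity
  have h1 := h.mul_alpha_le hpos (antitone_polynomial_step hη hβ ht₀) hL t
  have hα := h.alpha_pos hpos hL t
  have ht' : (1 : ℝ) ≤ t := by exact_mod_cast ht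
  have h2 : ((t : ℝ) + 1) * α t ≤ 4 := by nlinarith
  have h3 : α t ^ 2 ≤ 16 / ((t : ℝ) + 1) ^ 2 := by
    rw [le_div_iff₀ (by positivity), ← mul_pow, mul_comm]
    calc _ ≤ (4 : ℝ) ^ 2 := pow_le_pow_left₀ (by positivity) h2 2
      _ = 16 := by norm_num
  have h4 : ((t : ℝ) + t₀) ^ β ≤ t₀ ^ β * ((t : ℝ) + 1) ^ β := by
    rw [← Real.mul_rpow (by positivity) (by positivity)]
    gcongr
    nlinarith
  have h5 : ((t : ℝ) + 1) ^ (2 - β) = ((t : ℝ) + 1) ^ 2 / ((t : ℝ) + 1) ^ β := by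
    rw [Real.rpow_sub (by positivity), Real.rpow_two]
  push_cast
  rw [h5]
  calc _ = α t ^ 2 * ((t : ℝ) + t₀) ^ β / η := by field_simp
    _ ≤ 16 / ((t : ℝ) + 1) ^ 2 * (t₀ ^ β * ((t : ℝ) + 1) ^ β) / η := by gcongr
    _ = _ := by field_simp

end Rate

/-! ### The convergence rate -/

theorem theorem4 {n N : ℕ}
    (G : SimpleGraph (Fin n)) (hG : G.Connected)
    (W : Matrix (Fin n) (Fin n) ℝ) (hW : IsConsensusMatrix G W)
    (σ : ℝ) (hσ : σ = secondSingularValue W)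
    (L : ℝ) (hL : 0 < L)
    (f : Fin n → EuclideanSpace ℝ (Fin N) → ℝ)
    (hconv : ∀ i, ConvexOn ℝ Set.univ (f i))
    (hsmooth : ∀ i, IsLSmooth L (f i))
    (hcompact : IsCompact {z | IsMinOn (avgObjective f) Set.univ z})
    (xstar : EuclideanSpace ℝ (Fin N)) (fstar : ℝ)
    (hxstar : IsMinOn (avgObjective f) Set.univ xstar)
    (hfstar : fstar = avgObjective f xstar)
    (ε β η t₀ : ℝ) (hε : ε ∈ Set.Ioo (0 : ℝ) 1.4) (hβ : β = 0.6 + ε)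
    (hη : 0 < η) (ht₀ : 1 ≤ t₀)
    (α : ℕ → ℝ) (x v y s : ℕ → Fin n → EuclideanSpace ℝ (Fin N))
    (hrun : IsAccDNGDNSC W L f (fun t => η / ((t : ℝ) + t₀) ^ β) α x v y s)
    (hv0 : agentMean (v 0) ≠ xstar)
    (R : ℝ)
    (hR : R = Metric.diam (levelSet (avgObjective f)
      (2 * avgObjective f (agentMean (x 0)) - fstar + 2 * L * ‖agentMean (v 0) - xstar‖ ^ 2)))
    (hi : t₀ > 1 / (min (((σ + 3) / (σ + 2) * (3 / 4)) ^ (σ / (28 * β)))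
      ((16 / (15 + σ)) ^ (1 / β)) - 1))
    (hii : η < min (σ ^ 2 / (9 ^ 3 * L)) ((1 - σ) ^ 3 / (6144 * L)))
    (hiii : η < (stepConstD β t₀ * (β - 0.6) * (1 - σ) ^ 2 /
      (9216 * (t₀ + 1) ^ (2 - β) * L ^ ((2 : ℝ) / 3) *
        (4 + R ^ 2 / ‖agentMean (v 0) - xstar‖ ^ 2))) ^ ((3 : ℝ) / 2)) :
    ((fun t : ℕ => avgObjective f (agentMean (x t)) - fstar)
        =O[atTop] fun t : ℕ => 1 / (t : ℝ) ^ (2 - β)) ∧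
    ((fun t : ℕ => avgObjective f (agentMean (x t)) - fstar)
        =O[atTop] fun t : ℕ => 1 / (t : ℝ) ^ (1.4 - ε)) ∧
    ∀ i, (fun t : ℕ => avgObjective f (y t i) - fstar)
        =O[atTop] fun t : ℕ => 1 / (t : ℝ) ^ (1.4 - ε) := by
  have hn : 0 < n := Fin.pos_iff_nonempty.2 hG.nonempty
  obtain ⟨hε0, hε1⟩ := hε
  have hβ1 : 0.6 < β := by linarith
  -- a positive `η` below the second bound of `hii` forces the spectral gap
  have hσ1 : secondSingularValue W < 1 := by
    have h1 := hη.trans (hii.trans_le (min_le_right _ _))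
    have h2 : 0 < (1 - σ) ^ 3 := by
      rwa [lt_div_iff₀ (by positivity), zero_mul] at h1
    rw [← hσ]
    linarith [(Odd.pow_pos_iff (by decide : Odd 3)).1 h2]
  have hW' := hW.doublyStochastic
  have hpos : ∀ t : ℕ, 0 < η / ((t : ℝ) + t₀) ^ β := fun t => by positivity
  have hmono := antitone_polynomial_step hη (by linarith : 0 < β) ht₀
  have hlim : Tendsto (fun t : ℕ => η / ((t : ℝ) + t₀) ^ β) atTop (nhds 0) :=
    tendsto_polynomial_step (by linarith)
  have hsum : Summable fun t : ℕ => (η / ((t : ℝ) + t₀) ^ β) ^ 3 :=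
    summable_polynomial_step_pow (by norm_num at hβ1 ⊢; linarith) ht₀
  have hz : ∀ a, avgObjective f xstar ≤ avgObjective f a := fun a => hxstar (Set.mem_univ a)
  obtain ⟨C, hC, hev⟩ := hrun.exists_energy_bound hn hW' hσ1 hconv hsmooth hpos hmono hlim hsum
    hL hz
  -- reduction to eventual bounds by a multiple of `α ^ 2 / η`
  have hrate : ∀ (u : ℕ → ℝ) (K : ℝ), 0 ≤ K → (∀ t, 0 ≤ u t) →
      (∀ᶠ t : ℕ in atTop, u (t + 1) ≤ K * (α t ^ 2 / (η / ((t : ℝ) + t₀) ^ β))) →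
      u =O[atTop] fun t : ℕ => 1 / (t : ℝ) ^ (2 - β) := by
    intro u K hK hu0 hu
    refine IsBigO.of_bound (K * (16 * t₀ ^ β / η)) ?_
    rw [← map_add_atTop_eq_nat 1, eventually_map]
    filter_upwards [hu, eventually_ge_atTop 1] with t ht ht1
    rw [Real.norm_of_nonneg (hu0 _), Real.norm_of_nonneg (by positivity), mul_assoc]
    exact ht.trans (mul_le_mul_of_nonneg_left
      (hrun.ratio_le hη (by linarith) ht₀ hL ht1) hK)
  have ha := hrate (fun t => avgObjective f (agentMean (x t)) - fstar) C hC
    (fun t => by rw [hfstar]; exact sub_nonneg.2 (hz _))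
    (hev.mono fun t ht => by rw [hfstar]; exact ht.1)
  have he : (1.4 : ℝ) - ε = 2 - β := by rw [hβ]; norm_num; ring
  rw [he]
  refine ⟨ha, ha, fun i => ?_⟩
  refine hrate (fun t => avgObjective f (y t i) - fstar) ((1 + L) * (2 * C + (1 + L) * C))
    (by positivity) (fun t => by rw [hfstar]; exact sub_nonneg.2 (hz _)) ?_
  have hsmall : ∀ᶠ t : ℕ in atTop, 8 * (L * (η / (((t + 1 : ℕ) : ℝ) + t₀) ^ β)) ≤ 1 := by
    have := ((hlim.comp (tendsto_add_atTop_nat 1)).const_mul L).const_mul 8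
    rw [mul_zero, mul_zero] at this
    exact this.eventually_le_const one_pos
  filter_upwards [hev, (tendsto_add_atTop_nat 1).eventually hev, hsmall] with t h1 h2 h3
  have hy := hrun.objective_y_le hn hW' hconv hsmooth hpos hL hz h3 i
  rw [← hfstar] at hy h1 h2
  have hr := hrun.ratio_antitone hpos t.le_succ
  dsimp only at hr h2
  refine hy.trans ?_
  rw [mul_assoc]
  gcongr
  have h4 := h2.1.trans (mul_le_mul_of_nonneg_left hr hC)
  have h5 : (1 + L) * disagreement (y (t + 1)) ^ 2
      ≤ (1 + L) * (C * (α t ^ 2 / (η / ((t : ℝ) + t₀) ^ β))) := by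
    gcongr
    exact h1.2
  linarith
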